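/- Write $[\theta]=\{1,\dots,\theta\}$. For positive integers $n,\alpha,\theta,\rho$ with $n\alpha=\theta\rho$, an $(n,\alpha,\rho)$ FR (fractional repetition) code is a family $N_1,\dots,N_n$ of subsets of $[\theta]$, each of size $\alpha$, such that every element of $[\theta]$ lies in exactly $\rho$ of the $N_i$. Its file size for $k$ is $M(k)=\min_{|I|=k}\bigl|\bigcup_{i\in I}N_i\bigr|$, and $A(n,k,\alpha,\rho)$ denotes the maximum of $M(k)$ over all $(n,\alpha,\rho)$ FR codes. The code is called optimal if $M(k)=A(n,k,\alpha,\rho)$ for all $k\le\alpha$. Let $\mathcal S=(V,E)$ be a $\rho$-uniform $\alpha$-regular set system with $|V|=n$ (so $E$ is a set of $\rho$-subsets of $V$, called blocks, and every point lies in exactly $\alpha$ blocks), and let $\theta=|E|=n\alpha/\rho$. A labeling of $\mathcal S$ is a bijection $\sigma:E\to[\theta]$; it gives the $(n,\alpha,\rho)$ FR code $(N_v)_{v\in V}$ with $N_v=\{\sigma(e): v\in e\in E\}$. Its access-variance is $$\mathrm{Var}(\mathcal S_\sigma)=\sum_{v\in V}\Bigl(\sum_{e\in E,\ v\in e}\sigma(e)-\frac{\alpha(\theta+1)}{2}\Bigr)^2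 ,$$ and $\mathsf{MinVar}(\mathcal S)=\min_\sigma \mathrm{Var}(\mathcal S_\sigma)$ over all labelings of $\mathcal S$. A MinVar $(n,\alpha,\rho)$ FR code is the FR code given by such a set system $\mathcal S$ with a labeling $\sigma$ satisfying $\mathrm{Var}(\mathcal S_\sigma)=\mathsf{MinVar}(\mathcal S)$. **Corollary.** Let $r\ge 2$, $r\mid n$ and $\alpha=(r-1)\frac nr$. There exists an optimal MinVar $(n,\alpha,2)$ FR code with zero access-variance if one of the following conditions is satisfied: 1. $n=r=2$, or $n=r\ge 6$ and $n\not\equiv 0\pmod 4$; 2. $n=2r\ge 6$; 3. $n\ge 3r$, except when $r\equiv 0\pmod 4$ and $\frac nr$ is odd. -/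

import Mathlib

/-! ### Fractional repetition (FR) codes -/

/-- `IsFRCode n θ α ρ N`: the family `N₁, …, Nₙ` is an `(n, α, ρ)` FR code with symbol set
`[θ] = {1, …, θ}`, i.e. every `Nᵢ` is an `α`-subset of `[θ]` and every symbol of `[θ]` lies in
exactly `ρ` of the `Nᵢ`. -/
structure IsFRCode (n θ α ρ : ℕ) (N : Fin n → Finset ℕ) : Prop where
  n_pos : 0 < n
  symbols_pos : 0 < θ
  alpha_pos : 0 < α
  rho_pos : 0 < ρ
  mul_eq : n * α = θ * ρ
  subset : ∀ i, N i ⊆ Finset.Icc 1 θ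
  card_node : ∀ i, (N i).card = α
  card_symbol : ∀ s ∈ Finset.Icc 1 θ, (Finset.univ.filter fun i : Fin n => s ∈ N i).card = ρ

/-- The file size `M(k) = min_{|I| = k} |⋃_{i ∈ I} Nᵢ|` (a genuine minimum whenever `k ≤ n`). -/
noncomputable def fileSize {n : ℕ} (N : Fin n → Finset ℕ) (k : ℕ) : ℕ :=
  sInf {m : ℕ | ∃ I : Finset (Fin n), I.card = k ∧ (I.biUnion N).card = m}

/-- The set of all file sizes `M(k)` achieved by `(n, α, ρ)` FR codes; `A(n, k, α, ρ)` is its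
greatest element. The number `θ` of symbols is determined by `n α = θ ρ`. -/
def achievableFileSizes (n k α ρ : ℕ) : Set ℕ :=
  {M : ℕ | ∃ (θ : ℕ) (N : Fin n → Finset ℕ), IsFRCode n θ α ρ N ∧ fileSize N k = M}

/-- `N` is an optimal `(n, α, ρ)` FR code with symbol set `[θ]`: it is `k`-optimal, that is,
`M(k)` equals the maximum `A(n, k, α, ρ)`, for every `k ≤ α`. -/
def IsOptimalFRCode (n θ α ρ : ℕ) (N : Fin n → Finset ℕ) : Prop :=
  IsFRCode n θ α ρ N ∧ ∀ k ≤ α, IsGreatest (achievableFileSizes n k α ρ) (fileSize N k)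

/-! ### Set systems, block labelings and the access-variance -/

/-- A set system on the point set `V`: a finite set of blocks, each a finite set of points. -/
structure SetSystem (V : Type*) where
  blocks : Finset (Finset V)

namespace SetSystem

variable {V : Type*} [Fintype V] [DecidableEq V]

/-- Every block has exactly `ρ` points. -/
def IsUniform (S : SetSystem V) (ρ : ℕ) : Prop :=
  ∀ e ∈ S.blocks, e.card = ρ

/-- Every point lies in exactly `α` blocks. -/
def IsRegular (S : SetSystem V) (α : ℕ) : Prop :=
  ∀ x : V, (S.blocks.filter fun e => x ∈ e).card = α

/-- The number `θ` of blocks. -/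
def size (S : SetSystem V) : ℕ := S.blocks.card

/-- The incidence matrix: rows indexed by points, columns by blocks. -/
def incidence (S : SetSystem V) : Matrix V S.blocks ℝ :=
  fun x e => if x ∈ e.1 then 1 else 0

/-- A labeling of the blocks: a bijection from the set of blocks to `[θ] = {1, …, θ}`. -/
abbrev Labeling (S : SetSystem V) : Type _ := S.blocks ≃ Finset.Icc 1 S.size

/-- The FR code based on `S` with labeling `σ`: the node indexed by the point `x` stores the labels
of the blocks containing `x`. -/
def frCode (S : SetSystem V) (σ : S.Labeling) (x : V) : Finset ℕ :=
  (Finset.univ.filter fun e : S.blocks => x ∈ e.1).image fun e => (σ e : ℕ)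

/-- The overall popularities of the nodes: the incidence matrix times the vector of labels. -/
noncomputable def popularity (S : SetSystem V) (σ : S.Labeling) : V → ℝ :=
  S.incidence.mulVec fun e => ((σ e : ℕ) : ℝ)

/-- The access-variance of the labeling `σ` of the `α`-regular set system `S`: the sum over all
points of the squared deviation of the popularity from its average `α (θ + 1) / 2`. -/
noncomputable def accessVar (S : SetSystem V) (α : ℕ) (σ : S.Labeling) : ℝ :=
  ∑ x : V, (S.popularity σ x - (α : ℝ) * ((S.size : ℝ) + 1) / 2) ^ 2

/-- The least access-variance over all labelings of `S` (finitely many, and at least one). -/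
noncomputable def minVar (S : SetSystem V) (α : ℕ) : ℝ :=
  ⨅ σ : S.Labeling, S.accessVar α σ

end SetSystem

/-- `S` with the labeling `σ` yields a MinVar `(n, α, ρ)` FR code: `S` is a `ρ`-uniform `α`-regular
set system of order `n`, and `σ` attains the least access-variance. -/
structure IsMinVarFRCode (n α ρ : ℕ) (S : SetSystem (Fin n)) (σ : S.Labeling) : Prop where
  uniform : S.IsUniform ρ
  regular : S.IsRegular α
  minimal : S.accessVar α σ = S.minVar α

/-!
The code is built from the Turán graph with `r` parts of size `m = n / r`, whose edges are the
blocks.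

*Optimality.* In an `(n, α, 2)` code every symbol is stored twice, so the symbols that a set `I` of
`k` nodes shares with the remaining `n - k` nodes can be counted exactly. Choosing nodes greedily,
always taking the one that shares the most symbols with those already chosen, shows that every code
has `k` nodes storing at most `turanFileSize r α k` symbols (`IsFRCode.exists_card_biUnion_le`). For
the Turán graph the number of symbols stored by `k` nodes depends only on how the nodes are
distributed over the parts, and is smallest for an even distribution, where it equals the same
number (`IsFRCode.turanFileSize_le`). This holds for every labeling of the edges.

*Zero access-variance.* It remains to label the edges of the complete multipartite graph by
`1, …, N` with all vertex sums equal. Labels are centred around `0`, so that the sums must vanish.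
Call such a labeling balanced if every vertex meets equally many positive and negative labels. The
positive and the negative half of a balanced labeling can be pushed apart without changing the
vertex sums, so any magic graph can be wrapped in an edge-disjoint balanced one
(`IsDegreeMagic.sup`, `IsBalanced.sup`). Hence it suffices to decompose the graph into one magic
core and balanced layers. Balanced layers come from complete bipartite graphs with even sides
(`isBalanced_bip`), which decompose into copies of `K_{2,4}` and `K_{6,6}`, and from a few small
graphs with an explicit labeling. The cores are as follows.

* For even part sizes the whole graph is balanced (`isBalanced_multi_of_even`,
  `isBalanced_multi_two`).
* If `m ≥ 3` and `r` are odd, parts are removed four at a time, and the part size is lowered by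
  four, down to explicit graphs with three parts (`isDegreeMagic_multi_of_odd`).
* If `m ≥ 3` is odd and `r` is `2` modulo `4`, a magic rectangle joins one part to the other `r - 1`
  parts, and these span a balanced graph (`isDegreeMagic_multi_of_two_mod_four`).
* For `m = 1` and odd order, vertices are removed four at a time, down to `K_7` or `K_9`
  (`isDegreeMagic_completeOn_of_odd`). For order `2` modulo `4` beyond `K_2` and `K_6`, the core is
  a Möbius ladder, whose complement grows by balanced layers when two rungs are inserted
  (`isDegreeMagic_completeOn_range`).
-/

namespace DegreeMagic

open Finset

/-! ### Degree-magic and balanced graphs -/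

variable {V : Type*} [DecidableEq V]

/-- `D` contains exactly one of the two orientations of every edge of `G`. -/
structure IsOrientation (G : SimpleGraph V) (D : Finset (V × V)) : Prop where
  adj_iff : ∀ a b, G.Adj a b ↔ (a, b) ∈ D ∨ (b, a) ∈ D
  asymm : ∀ a b, (a, b) ∈ D → (b, a) ∉ D

/-- `f` is a degree-magic labeling, written in centred form: if `D` has `N` edges, the label
`i ∈ {1, …, N}` is replaced by `2 * i - (N + 1)`, so that the admissible values are the integers
`x` with `|x| < N` and `x + N` odd, and the labels at each vertex sum to `0`. -/
structure IsCentredLabeling (D : Finset (V × V)) (f : V × V → ℤ) : Prop where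
  injOn : Set.InjOn f D
  abs_lt : ∀ p ∈ D, |f p| < #D
  odd : ∀ p ∈ D, Odd (f p + #D)
  sum_eq : ∀ v, ∑ p ∈ D with p.1 = v ∨ p.2 = v, f p = 0

/-- A graph is degree-magic if its `N` edges can be labeled bijectively with `1, …, N` so that at
each vertex the average label is `(N + 1) / 2`. -/
def IsDegreeMagic (G : SimpleGraph V) : Prop :=
  ∃ D f, IsOrientation G D ∧ IsCentredLabeling D f

/-- A graph is balanced if it has a degree-magic labeling with an even number of edges for which
every vertex meets as many small labels (negative centred value) as large ones. Pushing the two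
halves of such a labeling apart keeps all vertex sums equal to zero. -/
def IsBalanced (G : SimpleGraph V) : Prop :=
  ∃ D f, IsOrientation G D ∧ IsCentredLabeling D f ∧ Even #D ∧
    ∀ v, ∑ p ∈ D with p.1 = v ∨ p.2 = v, (f p).sign = 0

theorem IsBalanced.isDegreeMagic {G : SimpleGraph V} (h : IsBalanced G) : IsDegreeMagic G := by
  obtain ⟨D, f, h₁, h₂, -⟩ := h
  exact ⟨D, f, h₁, h₂⟩

theorem isBalanced_bot : IsBalanced (⊥ : SimpleGraph V) :=
  ⟨∅, 0, ⟨by simp, by simp⟩, ⟨by simp, by simp, by simp, by simp⟩, by simp, by simp⟩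

omit [DecidableEq V] in
theorem IsOrientation.disjoint {G H : SimpleGraph V} {D E : Finset (V × V)}
    (hD : IsOrientation G D) (hE : IsOrientation H E) (hGH : Disjoint G H) : Disjoint D E := by
  rw [Finset.disjoint_left]
  rintro ⟨a, b⟩ h₁ h₂
  exact SimpleGraph.disjoint_left.1 hGH a b ((hD.adj_iff a b).2 (Or.inl h₁))
    ((hE.adj_iff a b).2 (Or.inl h₂))

theorem IsOrientation.sup {G H : SimpleGraph V} {D E : Finset (V × V)}
    (hD : IsOrientation G D) (hE : IsOrientation H E) (hGH : Disjoint G H) :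
    IsOrientation (G ⊔ H) (D ∪ E) := by
  have hGH' := SimpleGraph.disjoint_left.1 hGH
  have h₁ := hD.adj_iff
  have h₂ := hE.adj_iff
  refine ⟨fun a b => ?_, fun a b h h' => ?_⟩
  · simp only [SimpleGraph.sup_adj, Finset.mem_union, h₁, h₂]
    tauto
  · have h₃ := hD.asymm a b
    have h₄ := hE.asymm a b
    have h₅ := hGH' a b
    simp only [h₁, h₂, Finset.mem_union] at *
    tauto

/-- The labeling of a disjoint union in which `f` keeps the central labels and the two halves of
`g` are moved outwards by `c`. -/
def spread (D : Finset (V × V)) (f g : V × V → ℤ) (c : ℤ) (p : V × V) : ℤ :=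
  if p ∈ D then f p else g p + (g p).sign * c

theorem abs_and_sign_add_sign_mul {x c : ℤ} (hx : x ≠ 0) (hc : 0 ≤ c) :
    |x + x.sign * c| = |x| + c ∧ (x + x.sign * c).sign = x.sign := by
  rcases lt_or_gt_of_ne hx with h | h
  · rw [Int.sign_eq_neg_one_of_neg h, abs_of_neg h, abs_of_neg (by lia)]
    exact ⟨by lia, Int.sign_eq_neg_one_of_neg (by lia)⟩
  · rw [Int.sign_eq_one_of_pos h, abs_of_pos h, abs_of_pos (by lia)]
    exact ⟨by lia, Int.sign_eq_one_of_pos (by lia)⟩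

section Spread

variable {D E : Finset (V × V)} {f g : V × V → ℤ}

theorem spread_of_mem {c : ℤ} {p : V × V} (hp : p ∈ D) : spread D f g c p = f p := if_pos hp

theorem spread_of_disjoint {c : ℤ} (hDE : Disjoint D E) {p : V × V} (hp : p ∈ E) :
    spread D f g c p = g p + (g p).sign * c :=
  if_neg (Finset.disjoint_right.1 hDE hp)

theorem ne_zero_of_even (hg : IsCentredLabeling E g) (hE : Even #E) {p : V × V} (hp : p ∈ E) :
    g p ≠ 0 := by
  intro h
  have := hg.odd p hp
  rw [h, zero_add, Int.odd_coe_nat] at this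
  exact Nat.not_even_iff_odd.2 this hE

theorem sum_spread (hDE : Disjoint D E) (hf : IsCentredLabeling D f) (hg : IsCentredLabeling E g)
    (hs : ∀ v, ∑ p ∈ E with p.1 = v ∨ p.2 = v, (g p).sign = 0) (c : ℤ) (v : V) :
    ∑ p ∈ D ∪ E with p.1 = v ∨ p.2 = v, spread D f g c p = 0 := by
  rw [Finset.filter_union, Finset.sum_union (Finset.disjoint_filter_filter hDE),
    Finset.sum_congr rfl (g := f) fun p hp => spread_of_mem (Finset.mem_filter.1 hp).1, hf.sum_eq,
    Finset.sum_congr rfl fun p hp => spread_of_disjoint hDE (Finset.mem_filter.1 hp).1,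
    Finset.sum_add_distrib, hg.sum_eq, ← Finset.sum_mul, hs]
  simp

theorem IsCentredLabeling.spread (hDE : Disjoint D E) (hf : IsCentredLabeling D f)
    (hg : IsCentredLabeling E g) (hE : Even #E)
    (hs : ∀ v, ∑ p ∈ E with p.1 = v ∨ p.2 = v, (g p).sign = 0) :
    IsCentredLabeling (D ∪ E) (spread D f g #D) := by
  have hc : (0 : ℤ) ≤ #D := by positivity
  have hcard : ((#(D ∪ E) : ℕ) : ℤ) = #D + #E := by
    rw [Finset.card_union_of_disjoint hDE]; push_cast; rfl
  have habs : ∀ p ∈ E, |DegreeMagic.spread D f g #D p| = |g p| + #D := fun p hp => by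
    rw [spread_of_disjoint hDE hp, (abs_and_sign_add_sign_mul (ne_zero_of_even hg hE hp) hc).1]
  have hsep : ∀ p ∈ D, ∀ q ∈ E,
      DegreeMagic.spread D f g #D p ≠ DegreeMagic.spread D f g #D q := by
    intro p hp q hq h
    have h₁ := habs q hq
    have h₂ := hf.abs_lt p hp
    have h₃ := abs_nonneg (g q)
    rw [← h, spread_of_mem hp] at h₁
    lia
  refine ⟨?_, ?_, ?_, sum_spread hDE hf hg hs _⟩
  · intro p hp q hq h
    rw [Finset.mem_coe, Finset.mem_union] at hp hq
    rcases hp with hp | hp <;> rcases hq with hq | hq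
    · rw [spread_of_mem hp, spread_of_mem hq] at h
      exact hf.injOn hp hq h
    · exact absurd h (hsep p hp q hq)
    · exact absurd h.symm (hsep q hq p hp)
    · rw [spread_of_disjoint hDE hp, spread_of_disjoint hDE hq] at h
      have h₁ := (abs_and_sign_add_sign_mul (ne_zero_of_even hg hE hp) hc).2
      have h₂ := (abs_and_sign_add_sign_mul (ne_zero_of_even hg hE hq) hc).2
      rw [h, h₂] at h₁
      rw [h₁] at h
      exact hg.injOn hp hq (by lia)
  · intro p hp
    rw [hcard]
    rcases Finset.mem_union.1 hp with hp | hp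
    · rw [spread_of_mem hp]
      have := hf.abs_lt p hp
      lia
    · rw [habs p hp]
      have := hg.abs_lt p hp
      lia
  · intro p hp
    rw [hcard]
    rcases Finset.mem_union.1 hp with hp | hp
    · rw [spread_of_mem hp, ← add_assoc]
      exact (hf.odd p hp).add_even ((Int.even_coe_nat _).2 hE)
    · rw [spread_of_disjoint hDE hp]
      have h₁ := hg.odd p hp
      rcases lt_or_gt_of_ne (ne_zero_of_even hg hE hp) with h | h
      · rw [Int.sign_eq_neg_one_of_neg h]
        convert h₁ using 1
        ring
      · rw [Int.sign_eq_one_of_pos h]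
        have : g p + 1 * (#D : ℤ) + (#D + #E) = (g p + #E) + (#D + #D) := by ring
        rw [this]
        exact h₁.add_even ⟨_, rfl⟩

end Spread

/-- Around any degree-magic graph one can wrap an edge-disjoint balanced one. -/
theorem IsDegreeMagic.sup {G H : SimpleGraph V} (hG : IsDegreeMagic G) (hH : IsBalanced H)
    (hGH : Disjoint G H) : IsDegreeMagic (G ⊔ H) := by
  obtain ⟨D, f, hD, hf⟩ := hG
  obtain ⟨E, g, hE, hg, hev, hs⟩ := hH
  exact ⟨D ∪ E, _, hD.sup hE hGH, hf.spread (hD.disjoint hE hGH) hg hev hs⟩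

theorem IsBalanced.sup {G H : SimpleGraph V} (hG : IsBalanced G) (hH : IsBalanced H)
    (hGH : Disjoint G H) : IsBalanced (G ⊔ H) := by
  obtain ⟨D, f, hD, hf, hev', hs'⟩ := hG
  obtain ⟨E, g, hE, hg, hev, hs⟩ := hH
  have hDE := hD.disjoint hE hGH
  refine ⟨D ∪ E, _, hD.sup hE hGH, hf.spread hDE hg hev hs, ?_, fun v => ?_⟩
  · rw [Finset.card_union_of_disjoint hDE]
    exact hev'.add hev
  · rw [Finset.filter_union, Finset.sum_union (Finset.disjoint_filter_filter hDE),
      Finset.sum_congr rfl (g := fun p => (f p).sign) fun p hp => ?_, hs',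
      Finset.sum_congr rfl (g := fun p => (g p).sign) fun p hp => ?_, hs, add_zero]
    · have hp := (Finset.mem_filter.1 hp).1
      rw [spread_of_disjoint hDE hp,
        (abs_and_sign_add_sign_mul (ne_zero_of_even hg hev hp) (by positivity)).2]
    · rw [spread_of_mem (Finset.mem_filter.1 hp).1]

theorem IsDegreeMagic.of_sdiff {G H : SimpleGraph V} (hle : H ≤ G) (hH : IsDegreeMagic H)
    (h : IsBalanced (G \ H)) : IsDegreeMagic G := by
  have := hH.sup h disjoint_sdiff_self_right
  rwa [sup_sdiff_cancel_right hle] at this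

theorem IsBalanced.of_sdiff {G H : SimpleGraph V} (hle : H ≤ G) (hH : IsBalanced H)
    (h : IsBalanced (G \ H)) : IsBalanced G := by
  have := hH.sup h disjoint_sdiff_self_right
  rwa [sup_sdiff_cancel_right hle] at this

/-! ### Labelings given by an enumeration of the edges -/

section Enumeration

variable {ι : Type*} {T : Finset ι} {e : ι → V × V}

/-- The vertex sums of a labeling given along an enumeration `e` of the oriented edges. -/
theorem sum_image_invFunOn [Nonempty ι] (he : Set.InjOn e T) (F : ι → ℤ) (v : V) :
    ∑ p ∈ T.image e with p.1 = v ∨ p.2 = v, F (Function.invFunOn e T p) =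
      ∑ t ∈ T, if (e t).1 = v ∨ (e t).2 = v then F t else 0 := by
  rw [Finset.sum_filter, Finset.sum_image he]
  exact Finset.sum_congr rfl fun t ht => by rw [he.leftInvOn_invFunOn ht]

theorem isCentredLabeling_image [Nonempty ι] (he : Set.InjOn e T) {l : ι → ℤ}
    (hinj : Set.InjOn l T) (habs : ∀ t ∈ T, |l t| < #T) (hodd : ∀ t ∈ T, Odd (l t + #T))
    (hsum : ∀ v, ∑ t ∈ T, (if (e t).1 = v ∨ (e t).2 = v then l t else 0) = 0) :
    IsCentredLabeling (T.image e) (fun p => l (Function.invFunOn e T p)) := by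
  have hcard := Finset.card_image_of_injOn he
  have hinv : ∀ t ∈ T, Function.invFunOn e T (e t) = t := fun t ht => he.leftInvOn_invFunOn ht
  refine ⟨?_, ?_, ?_, fun v => by rw [sum_image_invFunOn he l, hsum]⟩
  · intro p hp q hq h
    obtain ⟨s, hs, rfl⟩ := Finset.mem_image.1 hp
    obtain ⟨t, ht, rfl⟩ := Finset.mem_image.1 hq
    simp only [hinv s hs, hinv t ht] at h
    rw [hinj hs ht h]
  · intro p hp
    obtain ⟨s, hs, rfl⟩ := Finset.mem_image.1 hp
    rw [hinv s hs, hcard]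
    exact habs s hs
  · intro p hp
    obtain ⟨s, hs, rfl⟩ := Finset.mem_image.1 hp
    rw [hinv s hs, hcard]
    exact hodd s hs

end Enumeration

/-! ### Labelings given by a list of edges -/

/-- The list `L` of edges, in the order of their labels, describes a degree-magic labeling of the
graph with vertices `0, …, k - 1` and adjacency relation `R`. The condition is decidable, so that
such a list serves as a certificate. -/
def IsMagicList (k : ℕ) (R : ℕ → ℕ → Prop) (L : List (ℕ × ℕ)) : Prop :=
  L.Nodup ∧ (∀ p ∈ L, p.1 < p.2 ∧ p.2 < k) ∧
  (∀ i < k, ∀ j < k, i < j → (R i j ↔ (i, j) ∈ L)) ∧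
  ∀ v < k, (L.zipIdx.map fun q =>
    if q.1.1 = v ∨ q.1.2 = v then 2 * (q.2 : ℤ) + 1 - L.length else 0).sum = 0

/-- The list `L` has even length and every vertex below `k` lies on equally many edges in the first
and in the second half of `L`. -/
def IsBalancedList (k : ℕ) (L : List (ℕ × ℕ)) : Prop :=
  Even L.length ∧
  ∀ v < k, (L.zipIdx.map fun q =>
    if q.1.1 = v ∨ q.1.2 = v then (2 * (q.2 : ℤ) + 1 - L.length).sign else 0).sum = 0

instance (k : ℕ) (R : ℕ → ℕ → Prop) [DecidableRel R] (L : List (ℕ × ℕ)) :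
    Decidable (IsMagicList k R L) := by
  unfold IsMagicList; infer_instance

instance (k : ℕ) (L : List (ℕ × ℕ)) : Decidable (IsBalancedList k L) := by
  unfold IsBalancedList; infer_instance

theorem sum_map_zipIdx {γ : Type*} (L : List γ) (F : γ → ℕ → ℤ) :
    (L.zipIdx.map fun q => F q.1 q.2).sum = ∑ i : Fin L.length, F L[i] i := by
  rw [← List.sum_ofFn]
  congr 1
  apply List.ext_getElem <;> simp

section OfList

variable {k : ℕ} {R : ℕ → ℕ → Prop} {L : List (ℕ × ℕ)} {φ : ℕ → V} {G : SimpleGraph V}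

theorem IsMagicList.isCentredLabeling (hL : IsMagicList k R L) (hne : 0 < L.length)
    (hφ : Set.InjOn φ (Set.Iio k)) (hsupp : ∀ x y, G.Adj x y → ∃ i < k, φ i = x)
    (hadj : ∀ i < k, ∀ j < k, i < j → (G.Adj (φ i) (φ j) ↔ R i j)) :
    ∃ D f, IsOrientation G D ∧ IsCentredLabeling D f ∧ #D = L.length ∧
      (IsBalancedList k L → ∀ v, ∑ p ∈ D with p.1 = v ∨ p.2 = v, (f p).sign = 0) := by
  obtain ⟨hnd, hlt, hR, hsum⟩ := hL
  have : Nonempty (Fin L.length) := ⟨⟨0, hne⟩⟩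
  set e : Fin L.length → V × V := fun i => (φ (L[i]).1, φ (L[i]).2) with he_def
  have hmem : ∀ i : Fin L.length, L[i] ∈ L := fun i => List.getElem_mem _
  have h1 : ∀ i : Fin L.length, (L[i]).1 < k := fun i => (hlt _ (hmem i)).1.trans (hlt _ (hmem i)).2
  have h2 : ∀ i : Fin L.length, (L[i]).2 < k := fun i => (hlt _ (hmem i)).2
  have he : Set.InjOn e (Finset.univ : Finset (Fin L.length)) := by
    intro i _ j _ h
    have ha := hφ (h1 i) (h1 j) (congrArg Prod.fst h)
    have hb := hφ (h2 i) (h2 j) (congrArg Prod.snd h)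
    exact Fin.ext ((hnd.getElem_inj_iff).1 (Prod.ext ha hb))
  -- Both vertex conditions hold on the image of `φ` by assumption and are void off it.
  have hvert : ∀ F : ℕ → ℤ, (∀ v < k, (L.zipIdx.map fun q =>
      if q.1.1 = v ∨ q.1.2 = v then F q.2 else 0).sum = 0) → ∀ x : V,
      ∑ i : Fin L.length, (if (e i).1 = x ∨ (e i).2 = x then F i else 0) = 0 := by
    intro F hF x
    by_cases hx : ∃ v < k, φ v = x
    · obtain ⟨v, hv, rfl⟩ := hx
      refine Eq.trans ?_ (hF v hv)
      rw [sum_map_zipIdx L fun p i => if p.1 = v ∨ p.2 = v then F i else 0]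
      refine Finset.sum_congr rfl fun i _ => ?_
      have ha : (e i).1 = φ v ↔ (L[i]).1 = v := hφ.eq_iff (h1 i) hv
      have hb : (e i).2 = φ v ↔ (L[i]).2 = v := hφ.eq_iff (h2 i) hv
      simp only [ha, hb]
    · refine Finset.sum_eq_zero fun i _ => if_neg ?_
      rintro (h | h)
      · exact hx ⟨_, h1 i, h⟩
      · exact hx ⟨_, h2 i, h⟩
  have hD : ∀ i < k, ∀ j < k, ((φ i, φ j) ∈ Finset.univ.image e ↔ (i, j) ∈ L) := by
    intro i hi j hj
    simp only [Finset.mem_image, Finset.mem_univ, true_and]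
    constructor
    · rintro ⟨t, ht⟩
      have ha := hφ (h1 t) hi (congrArg Prod.fst ht)
      have hb := hφ (h2 t) hj (congrArg Prod.snd ht)
      rw [← ha, ← hb]
      exact hmem t
    · intro h
      obtain ⟨t, ht, hE⟩ := List.getElem_of_mem h
      exact ⟨⟨t, ht⟩, by simp [he_def, hE]⟩
  have hDφ : ∀ x y, (x, y) ∈ Finset.univ.image e → ∃ i < k, ∃ j < k, φ i = x ∧ φ j = y := by
    intro x y h
    obtain ⟨t, -, ht⟩ := Finset.mem_image.1 h
    exact ⟨_, h1 t, _, h2 t, congrArg Prod.fst ht, congrArg Prod.snd ht⟩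
  refine ⟨Finset.univ.image e, _, ⟨fun x y => ?_, fun x y h h' => ?_⟩,
    isCentredLabeling_image he (l := fun i => 2 * (i : ℤ) + 1 - L.length) ?_ ?_ ?_ ?_, ?_, ?_⟩
  · constructor
    · intro h
      obtain ⟨i, hi, rfl⟩ := hsupp _ _ h
      obtain ⟨j, hj, rfl⟩ := hsupp _ _ h.symm
      rw [hD i hi j hj, hD j hj i hi]
      rcases lt_trichotomy i j with hij | rfl | hij
      · exact Or.inl ((hR i hi j hj hij).1 ((hadj i hi j hj hij).1 h))
      · exact absurd h (G.loopless.irrefl _)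
      · exact Or.inr ((hR j hj i hi hij).1 ((hadj j hj i hi hij).1 h.symm))
    · rintro (h | h)
      · obtain ⟨i, hi, j, hj, rfl, rfl⟩ := hDφ _ _ h
        rw [hD i hi j hj] at h
        exact (hadj i hi j hj (hlt _ h).1).2 ((hR i hi j hj (hlt _ h).1).2 h)
      · obtain ⟨i, hi, j, hj, rfl, rfl⟩ := hDφ _ _ h
        rw [hD i hi j hj] at h
        exact ((hadj i hi j hj (hlt _ h).1).2 ((hR i hi j hj (hlt _ h).1).2 h)).symm
  · obtain ⟨i, hi, j, hj, rfl, rfl⟩ := hDφ _ _ h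
    rw [hD i hi j hj] at h
    rw [hD j hj i hi] at h'
    exact absurd (hlt _ h).1 (hlt _ h').1.asymm
  · intro i _ j _ h
    exact Fin.ext (by simpa using h)
  · intro i _
    have := i.2
    rw [Finset.card_univ, Fintype.card_fin, abs_lt]
    constructor <;> lia
  · intro i _
    rw [Finset.card_univ, Fintype.card_fin]
    exact ⟨i, by ring⟩
  · exact hvert (fun i => 2 * (i : ℤ) + 1 - L.length) hsum
  · rw [Finset.card_image_of_injOn he, Finset.card_univ, Fintype.card_fin]
  · intro hb v
    rw [sum_image_invFunOn he fun i : Fin L.length => (2 * (i : ℤ) + 1 - L.length).sign]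
    exact hvert (fun i => (2 * (i : ℤ) + 1 - L.length).sign) hb.2 v

/-- A certificate list proves that `G`, with vertices enumerated by `φ`, is degree-magic. -/
theorem IsMagicList.isDegreeMagic (hL : IsMagicList k R L) (hne : 0 < L.length)
    (hφ : Set.InjOn φ (Set.Iio k)) (hsupp : ∀ x y, G.Adj x y → ∃ i < k, φ i = x)
    (hadj : ∀ i < k, ∀ j < k, i < j → (G.Adj (φ i) (φ j) ↔ R i j)) : IsDegreeMagic G := by
  obtain ⟨D, f, hD, hf, -⟩ := hL.isCentredLabeling hne hφ hsupp hadj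
  exact ⟨D, f, hD, hf⟩

theorem IsMagicList.isBalanced (hL : IsMagicList k R L) (hb : IsBalancedList k L)
    (hne : 0 < L.length) (hφ : Set.InjOn φ (Set.Iio k))
    (hsupp : ∀ x y, G.Adj x y → ∃ i < k, φ i = x)
    (hadj : ∀ i < k, ∀ j < k, i < j → (G.Adj (φ i) (φ j) ↔ R i j)) : IsBalanced G := by
  obtain ⟨D, f, hD, hf, hcard, hs⟩ := hL.isCentredLabeling hne hφ hsupp hadj
  exact ⟨D, f, hD, hf, hcard ▸ hb.1, hs hb⟩

end OfList

/-! ### Explicit labelings of small graphs -/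

/-- A balanced labeling of `K_{2,4}` with parts `{0, 1}` and `{2, …, 5}`. -/
def listBip24 : List (ℕ × ℕ) :=
  [(0, 2), (1, 3), (1, 5), (0, 4), (1, 4), (0, 5), (0, 3), (1, 2)]

theorem isMagicList_listBip24 :
    IsMagicList 6 (fun i j => i < 2 ∧ 2 ≤ j) listBip24 := by
  decide +kernel

theorem isBalancedList_listBip24 : IsBalancedList 6 listBip24 := by
  decide +kernel

/-- A balanced labeling of `K_{6,6}` with parts `{0, …, 5}` and `{6, …, 11}`. -/
def listBip66 : List (ℕ × ℕ) :=
  [(5, 11), (0, 6), (3, 10), (2, 7), (1, 10), (3, 9), (4, 8), (2, 9), (0, 8), (3, 6), (1, 8),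
   (5, 7), (2, 11), (4, 7), (0, 11), (1, 9), (5, 6), (4, 10), (1, 7), (4, 6), (5, 9), (2, 8),
   (4, 11), (0, 10), (5, 10), (1, 11), (3, 8), (2, 6), (4, 9), (0, 7), (0, 9), (3, 7), (3, 11),
   (1, 6), (5, 8), (2, 10)]

theorem isMagicList_listBip66 :
    IsMagicList 12 (fun i j => i < 6 ∧ 6 ≤ j) listBip66 := by
  decide +kernel

theorem isBalancedList_listBip66 : IsBalancedList 12 listBip66 := by
  decide +kernel

/-- A balanced labeling of the octahedron, with parts `{2i, 2i + 1}` for `i < 3`. -/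
def listMulti23 : List (ℕ × ℕ) :=
  [(2, 5), (1, 3), (1, 4), (0, 4), (0, 2), (3, 5), (0, 5), (3, 4), (1, 2), (0, 3), (2, 4), (1, 5)]

theorem isMagicList_listMulti23 :
    IsMagicList 6 (fun i j => i / 2 ≠ j / 2) listMulti23 := by
  decide +kernel

theorem isBalancedList_listMulti23 : IsBalancedList 6 listMulti23 := by
  decide +kernel

/-- A balanced labeling of the complete multipartite graph with parts `{2i, 2i + 1}` for `i < 4`. -/
def listMulti24 : List (ℕ × ℕ) :=
  [(1, 5), (4, 6), (2, 4), (3, 5), (3, 7), (0, 6), (5, 7), (0, 2), (1, 6), (0, 4), (1, 3), (2, 7),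
   (0, 7), (1, 2), (3, 6), (0, 3), (4, 7), (2, 5), (1, 4), (2, 6), (1, 7), (0, 5), (5, 6), (3, 4)]

theorem isMagicList_listMulti24 :
    IsMagicList 8 (fun i j => i / 2 ≠ j / 2) listMulti24 := by
  decide +kernel

theorem isBalancedList_listMulti24 : IsBalancedList 8 listMulti24 := by
  decide +kernel

/-- A degree-magic labeling of the complete multipartite graph with parts `{3i, 3i + 1, 3i + 2}`
for `i < 3`. -/
def listMulti33 : List (ℕ × ℕ) :=
  [(4, 8), (1, 5), (4, 7), (2, 3), (5, 6), (1, 3), (2, 6), (0, 6), (3, 7), (0, 7), (5, 8), (2, 7),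
   (0, 3), (0, 8), (1, 8), (1, 6), (0, 4), (2, 8), (1, 4), (2, 5), (4, 6), (0, 5), (2, 4), (5, 7),
   (3, 8), (1, 7), (3, 6)]

theorem isMagicList_listMulti33 :
    IsMagicList 9 (fun i j => i / 3 ≠ j / 3) listMulti33 := by
  decide +kernel

/-- A degree-magic labeling of the complete multipartite graph with parts `{5i, …, 5i + 4}`
for `i < 3`. -/
def listMulti53 : List (ℕ × ℕ) :=
  [(0, 11), (0, 10), (4, 10), (6, 14), (3, 7), (1, 5), (2, 5), (2, 9), (3, 11), (1, 13), (4, 11),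
   (9, 14), (1, 8), (5, 12), (6, 13), (8, 10), (0, 12), (2, 13), (3, 9), (8, 12), (7, 14), (7, 10),
   (4, 13), (9, 11), (8, 11), (3, 14), (4, 6), (1, 7), (2, 12), (0, 7), (9, 12), (0, 6), (2, 10),
   (5, 10), (3, 6), (2, 7), (3, 8), (4, 14), (1, 6), (9, 13), (5, 11), (4, 5), (1, 14), (5, 13),
   (2, 6), (1, 12), (8, 14), (0, 8), (6, 12), (8, 13), (4, 8), (7, 12), (1, 9), (0, 13), (4, 7),
   (2, 14), (3, 13), (9, 10), (4, 12), (6, 11), (3, 5), (7, 11), (3, 12), (0, 9), (0, 5), (5, 14),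
   (0, 14), (3, 10), (7, 13), (1, 10), (4, 9), (1, 11), (2, 8), (6, 10), (2, 11)]

theorem isMagicList_listMulti53 :
    IsMagicList 15 (fun i j => i / 5 ≠ j / 5) listMulti53 := by
  decide +kernel

/-- A balanced labeling of the complete multipartite graph with parts `{3i, 3i + 1, 3i + 2}`
for `i < 5`. -/
def listMulti35 : List (ℕ × ℕ) :=
  [(3, 8), (2, 7), (2, 6), (5, 10), (4, 14), (10, 13), (1, 9), (3, 13), (2, 3), (0, 11), (10, 12),
   (5, 9), (7, 12), (1, 7), (1, 10), (9, 14), (11, 14), (7, 13), (6, 11), (6, 12), (0, 4), (4, 9),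
   (8, 10), (2, 9), (0, 14), (2, 11), (0, 3), (5, 11), (0, 8), (6, 9), (8, 12), (5, 8), (5, 12),
   (5, 7), (0, 12), (4, 13), (11, 13), (4, 10), (1, 13), (3, 6), (2, 4), (6, 14), (1, 8), (7, 14),
   (1, 3), (1, 14), (11, 12), (0, 6), (6, 13), (1, 4), (5, 6), (4, 11), (4, 12), (0, 10), (3, 14),
   (3, 7), (5, 13), (2, 8), (7, 9), (8, 9), (4, 8), (2, 13), (8, 14), (1, 5), (5, 14), (0, 9),
   (0, 7), (8, 11), (3, 10), (3, 12), (7, 10), (1, 12), (1, 6), (9, 13), (2, 12), (3, 11), (8, 13),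
   (1, 11), (2, 14), (4, 7), (0, 5), (2, 10), (0, 13), (6, 10), (2, 5), (9, 12), (4, 6), (7, 11),
   (10, 14), (3, 9)]

theorem isMagicList_listMulti35 :
    IsMagicList 15 (fun i j => i / 3 ≠ j / 3) listMulti35 := by
  decide +kernel

theorem isBalancedList_listMulti35 : IsBalancedList 15 listMulti35 := by
  decide +kernel

/-- A degree-magic labeling of `K_6`. -/
def listComplete6 : List (ℕ × ℕ) :=
  [(0, 5), (3, 5), (2, 4), (1, 2), (0, 1), (0, 4), (2, 3), (1, 3), (1, 4), (3, 4), (2, 5), (4, 5),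
   (0, 3), (1, 5), (0, 2)]

theorem isMagicList_listComplete6 :
    IsMagicList 6 (fun i j => i ≠ j) listComplete6 := by
  decide +kernel

/-- A degree-magic labeling of `K_7`. -/
def listComplete7 : List (ℕ × ℕ) :=
  [(2, 3), (4, 6), (1, 5), (0, 3), (1, 3), (5, 6), (0, 4), (1, 6), (0, 5), (2, 5), (0, 2), (2, 4),
   (1, 4), (2, 6), (3, 4), (0, 6), (4, 5), (1, 2), (0, 1), (3, 6), (3, 5)]

theorem isMagicList_listComplete7 :
    IsMagicList 7 (fun i j => i ≠ j) listComplete7 := by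
  decide +kernel

/-- A degree-magic labeling of `K_9`. -/
def listComplete9 : List (ℕ × ℕ) :=
  [(0, 2), (5, 7), (1, 6), (0, 1), (2, 4), (6, 8), (0, 7), (3, 4), (3, 8), (5, 8), (1, 3), (1, 7),
   (2, 3), (4, 6), (2, 6), (0, 8), (5, 6), (2, 5), (3, 7), (4, 5), (1, 4), (7, 8), (4, 8), (3, 5),
   (0, 5), (0, 4), (2, 7), (6, 7), (1, 8), (3, 6), (4, 7), (1, 5), (2, 8), (0, 3), (0, 6), (1, 2)]

theorem isMagicList_listComplete9 :
    IsMagicList 9 (fun i j => i ≠ j) listComplete9 := by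
  decide +kernel

/-- A balanced labeling of `K_7` without the edges of the triangle on `{4, 5, 6}`. -/
def listCompleteDiff : List (ℕ × ℕ) :=
  [(0, 6), (3, 4), (1, 2), (1, 5), (0, 3), (2, 5), (3, 6), (1, 4), (0, 2), (0, 1), (2, 4), (2, 6),
   (3, 5), (1, 3), (0, 5), (2, 3), (0, 4), (1, 6)]

theorem isMagicList_listCompleteDiff :
    IsMagicList 7 (fun i _ => i < 4) listCompleteDiff := by
  decide +kernel

theorem isBalancedList_listCompleteDiff : IsBalancedList 7 listCompleteDiff := by
  decide +kernel

/-- A balanced labeling of the complement of the Möbius ladder with sides `0, …, 4`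
and `5, …, 9`. -/
def listLadderCompl5 : List (ℕ × ℕ) :=
  [(0, 7), (2, 9), (5, 8), (5, 6), (1, 3), (3, 4), (0, 4), (2, 3), (6, 7), (4, 6), (8, 9), (2, 5),
   (1, 9), (0, 1), (7, 8), (1, 8), (7, 9), (1, 4), (3, 6), (0, 2), (5, 9), (6, 8), (5, 7), (2, 4),
   (0, 3), (0, 8), (1, 2), (4, 7), (6, 9), (3, 5)]

theorem isMagicList_listLadderCompl5 :
    IsMagicList 10 (fun i j => ¬ (i < 5 ∧ 5 ≤ j ∧
      (i + 5 = j ∨ (i + 1) % 5 + 5 = j ∨ i = (j + 1) % 5))) listLadderCompl5 := by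
  decide +kernel

theorem isBalancedList_listLadderCompl5 : IsBalancedList 10 listLadderCompl5 := by
  decide +kernel

/-- A balanced labeling of the edges by which the complement of the Möbius ladder grows near its
seam when two rungs are inserted, apart from a complete bipartite graph. The rungs next to the seam
are `{0, 1}` and `{2, 3}`, the new ones are `{4, 5}` and `{6, 7}`, and the even vertices form one
side of the ladder. -/
def listLadderStep : List (ℕ × ℕ) :=
  [(3, 5), (1, 7), (4, 6), (0, 4), (0, 3), (1, 2), (2, 6), (5, 7), (2, 5), (1, 6), (0, 7), (2, 4),
   (3, 7), (0, 6), (3, 4), (1, 5)]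

theorem isMagicList_listLadderStep :
    IsMagicList 8 (fun i j => (i, j) = (0, 3) ∨ (i, j) = (1, 2) ∨ (i, j) = (4, 6) ∨
      (i, j) = (5, 7) ∨ (i < 4 ∧ 4 ≤ j ∧ (i, j) ≠ (0, 5) ∧ (i, j) ≠ (1, 4) ∧ (i, j) ≠ (2, 7) ∧
        (i, j) ≠ (3, 6))) listLadderStep := by
  decide +kernel

theorem isBalancedList_listLadderStep : IsBalancedList 8 listLadderStep := by
  decide +kernel

/-! ### Complete bipartite graphs -/

section Bipartite

variable {V : Type*} [DecidableEq V]

/-- The complete bipartite graph between the disjoint vertex sets `X` and `Y`. -/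
def bip (X Y : Finset V) : SimpleGraph V where
  Adj a b := a ≠ b ∧ (a ∈ X ∧ b ∈ Y ∨ a ∈ Y ∧ b ∈ X)
  symm := ⟨fun _ _ h => ⟨h.1.symm, h.2.symm.imp And.symm And.symm⟩⟩
  loopless := ⟨fun _ h => h.1 rfl⟩

omit [DecidableEq V] in
theorem bip_adj {X Y : Finset V} {a b : V} :
    (bip X Y).Adj a b ↔ a ≠ b ∧ (a ∈ X ∧ b ∈ Y ∨ a ∈ Y ∧ b ∈ X) := Iff.rfl

omit [DecidableEq V] in
theorem bip_comm (X Y : Finset V) : bip X Y = bip Y X := by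
  ext a b
  simp only [bip_adj]
  tauto

omit [DecidableEq V] in
theorem exists_enum {X : Finset V} {k : ℕ} (hk : 0 < k) (hX : #X = k) :
    ∃ φ : ℕ → V, Set.InjOn φ (Set.Iio k) ∧ ∀ x, x ∈ X ↔ ∃ i < k, φ i = x := by
  subst hX
  obtain ⟨x₀, -⟩ := Finset.card_pos.1 hk
  let e := X.equivFin
  refine ⟨fun i => if h : i < #X then (e.symm ⟨i, h⟩ : V) else x₀, ?_, fun x => ?_⟩
  · intro i hi j hj h
    rw [Set.mem_Iio] at hi hj
    simp only [hi, hj, dif_pos, Subtype.coe_inj, e.symm.injective.eq_iff] at h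
    exact congrArg Fin.val h
  · constructor
    · intro h
      exact ⟨e ⟨x, h⟩, (e ⟨x, h⟩).2, by simp⟩
    · rintro ⟨i, hi, rfl⟩
      simp [hi]

/-- An enumeration of the disjoint union of two finite sets. -/
theorem exists_enum_union {X Y : Finset V} (hXY : Disjoint X Y) {k l : ℕ} (hk : 0 < k)
    (hl : 0 < l) (hX : #X = k) (hY : #Y = l) :
    ∃ φ : ℕ → V, Set.InjOn φ (Set.Iio (k + l)) ∧ (∀ x, x ∈ X ∪ Y ↔ ∃ i < k + l, φ i = x) ∧
      ∀ i < k + l, (φ i ∈ X ↔ i < k) ∧ (φ i ∈ Y ↔ k ≤ i) := by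
  obtain ⟨x, hx, hX'⟩ := exists_enum hk hX
  obtain ⟨y, hy, hY'⟩ := exists_enum hl hY
  have hxX : ∀ i < k, x i ∈ X := fun i hi => (hX' _).2 ⟨i, hi, rfl⟩
  have hyY : ∀ i < l, y i ∈ Y := fun i hi => (hY' _).2 ⟨i, hi, rfl⟩
  have hXY' : ∀ a, a ∈ X → a ∉ Y :=
    fun _ h => Finset.disjoint_left.1 hXY h
  have hmem : ∀ i < k + l, ((if i < k then x i else y (i - k)) ∈ X ↔ i < k) ∧
      ((if i < k then x i else y (i - k)) ∈ Y ↔ k ≤ i) := by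
    intro i hi
    split_ifs with h
    · exact ⟨by simp [h, hxX i h], by simp [h, hXY' _ (hxX i h)]⟩
    · have hY₁ := hyY (i - k) (by lia)
      exact ⟨by simp only [h, iff_false]; exact fun h' => hXY' _ h' hY₁, by simp [hY₁]; lia⟩
  refine ⟨fun i => if i < k then x i else y (i - k), ?_, fun a => ?_, hmem⟩
  · intro i hi j hj h
    rw [Set.mem_Iio] at hi hj
    have h₁ := (hmem i hi).1
    have h₂ := (hmem j hj).1
    simp only at h
    rw [h, h₂] at h₁
    by_cases hik : i < k
    · have hjk := h₁.2 hik
      simp only [hik, hjk, if_true] at h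
      exact hx hik hjk h
    · have hjk : ¬ j < k := fun h => hik (h₁.1 h)
      simp only [hik, hjk, if_false] at h
      have := hy (show i - k < l by lia) (show j - k < l by lia) h
      lia
  · rw [Finset.mem_union]
    constructor
    · rintro (h | h)
      · obtain ⟨i, hi, rfl⟩ := (hX' _).1 h
        exact ⟨i, by lia, if_pos hi⟩
      · obtain ⟨i, hi, rfl⟩ := (hY' _).1 h
        exact ⟨k + i, by lia, by simp⟩
    · rintro ⟨i, hi, rfl⟩
      rcases lt_or_ge i k with h | h
      · exact Or.inl ((hmem i hi).1.2 h)
      · exact Or.inr ((hmem i hi).2.2 h)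

theorem isBalanced_bip_of_list {X Y : Finset V} (hXY : Disjoint X Y) {k l : ℕ} (hk : 0 < k)
    (hl : 0 < l) (hX : #X = k) (hY : #Y = l) {L : List (ℕ × ℕ)} (hne : 0 < L.length)
    (hL : IsMagicList (k + l) (fun i j => i < k ∧ k ≤ j) L) (hb : IsBalancedList (k + l) L) :
    IsBalanced (bip X Y) := by
  obtain ⟨φ, hφ, hmem, hXY'⟩ := exists_enum_union hXY hk hl hX hY
  refine hL.isBalanced hb hne hφ (fun x y h => (hmem x).1 ?_) fun i hi j hj hij => ?_
  · rw [bip_adj] at h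
    rw [Finset.mem_union]
    tauto
  · have := hφ.ne hi hj hij.ne
    simp only [bip_adj, hXY' i hi, hXY' j hj]
    constructor
    · rintro ⟨-, h | h⟩ <;> lia
    · exact fun h => ⟨this, Or.inl h⟩

theorem IsBalanced.bip_union {X X' Y : Finset V} (hX : Disjoint X X') (h : IsBalanced (bip X Y))
    (h' : IsBalanced (bip X' Y)) (hXY : Disjoint (X ∪ X') Y) : IsBalanced (bip (X ∪ X') Y) := by
  have heq : bip (X ∪ X') Y = bip X Y ⊔ bip X' Y := by
    ext a b
    simp only [bip_adj, SimpleGraph.sup_adj, Finset.mem_union]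
    tauto
  rw [heq]
  refine h.sup h' (SimpleGraph.disjoint_left.2 fun a b => ?_)
  simp only [bip_adj]
  have h₁ : ∀ a, a ∈ X → a ∉ X' :=
    fun _ h => Finset.disjoint_left.1 hX h
  have h₂ : ∀ a, a ∈ X ∪ X' → a ∉ Y :=
    fun _ h => Finset.disjoint_left.1 hXY h
  simp only [Finset.mem_union] at h₂
  have := h₁ a; have := h₁ b; have := h₂ a; have := h₂ b
  tauto

/-- A splitting off argument: if complete bipartite graphs with left sides of size `c` are balanced,
then so are those whose left side has size a multiple of `c`. -/
theorem isBalanced_bip_mul {Y : Finset V} {c : ℕ}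
    (h : ∀ X : Finset V, Disjoint X Y → #X = c → IsBalanced (bip X Y)) (k : ℕ) :
    ∀ X : Finset V, Disjoint X Y → #X = c * k → IsBalanced (bip X Y) := by
  induction k with
  | zero =>
    intro X _ hX
    rw [mul_zero, Finset.card_eq_zero] at hX
    have : bip X Y = ⊥ := by ext a b; simp [bip_adj, hX]
    rw [this]
    exact isBalanced_bot
  | succ k ih =>
    intro X hXY hX
    obtain ⟨X', hX', hc⟩ := Finset.exists_subset_card_eq (s := X) (n := c) (by rw [hX]; lia)
    have hu : X' ∪ X \ X' = X := Finset.union_sdiff_of_subset hX'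
    rw [← hu]
    refine IsBalanced.bip_union Finset.disjoint_sdiff (h X' (hXY.mono_left hX') hc)
      (ih _ (hXY.mono_left Finset.sdiff_subset) ?_) (by rwa [hu])
    rw [Finset.card_sdiff_of_subset hX', hX, hc]
    lia

theorem isBalanced_bip_of_four_dvd {X Y : Finset V} (hXY : Disjoint X Y) (hX : Even #X)
    (hY : 4 ∣ #Y) : IsBalanced (bip X Y) := by
  obtain ⟨j, hj⟩ := even_iff_two_dvd.1 hX
  obtain ⟨k, hk⟩ := hY
  refine isBalanced_bip_mul (fun X' hX' hc => ?_) j X hXY hj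
  rw [bip_comm]
  refine isBalanced_bip_mul (fun Y' hY' hc' => ?_) k Y hX'.symm hk
  rw [bip_comm]
  exact isBalanced_bip_of_list hY'.symm (by lia) (by lia) hc hc' (by decide) isMagicList_listBip24
    isBalancedList_listBip24

/-- For even side lengths, `K_{x,y}` is balanced unless both lengths are `2` modulo `4` and one of
them equals `2`. -/
theorem isBalanced_bip {X Y : Finset V} (hXY : Disjoint X Y) (hX : Even #X) (hY : Even #Y)
    (h : 4 ∣ #X ∨ 4 ∣ #Y ∨ 6 ≤ #X ∧ 6 ≤ #Y) : IsBalanced (bip X Y) := by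
  by_cases hY4 : 4 ∣ #Y
  · exact isBalanced_bip_of_four_dvd hXY hX hY4
  by_cases hX4 : 4 ∣ #X
  · rw [bip_comm]
    exact isBalanced_bip_of_four_dvd hXY.symm hY hX4
  obtain ⟨hX6, hY6⟩ : 6 ≤ #X ∧ 6 ≤ #Y := by tauto
  rw [Nat.even_iff] at hX hY
  obtain ⟨X', hX', hc⟩ := Finset.exists_subset_card_eq hX6
  obtain ⟨Y', hY', hc'⟩ := Finset.exists_subset_card_eq hY6
  have hu : X' ∪ X \ X' = X := Finset.union_sdiff_of_subset hX'
  have hu' : Y' ∪ Y \ Y' = Y := Finset.union_sdiff_of_subset hY'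
  have hcs : #(X \ X') = #X - 6 := by rw [Finset.card_sdiff_of_subset hX', hc]
  have hcs' : #(Y \ Y') = #Y - 6 := by rw [Finset.card_sdiff_of_subset hY', hc']
  have hX'Y := hXY.mono_left hX'
  rw [← hu]
  refine IsBalanced.bip_union Finset.disjoint_sdiff ?_ ?_ (by rwa [hu])
  · rw [← hu', bip_comm]
    refine IsBalanced.bip_union Finset.disjoint_sdiff ?_ ?_ (by rw [hu']; exact hX'Y.symm)
    · exact isBalanced_bip_of_list (hX'Y.mono_right hY').symm (by lia) (by lia) hc' hc (by decide)
        isMagicList_listBip66 isBalancedList_listBip66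
    · rw [bip_comm]
      refine isBalanced_bip_of_four_dvd (hX'Y.mono_right Finset.sdiff_subset) ?_ ?_
      · rw [hc]; decide
      · rw [hcs']; lia
  · rw [bip_comm]
    refine isBalanced_bip_of_four_dvd (hXY.mono_left Finset.sdiff_subset).symm ?_ ?_
    · rw [Nat.even_iff]; exact hY
    · rw [hcs]; lia

end Bipartite

/-! ### Complete multipartite graphs -/

section Multipartite

variable {α β : Type*} [DecidableEq α] [DecidableEq β]

/-- The complete multipartite graph with the parts `{i} × J` for `i ∈ I`. -/
def multi (I : Finset α) (J : Finset β) : SimpleGraph (α × β) where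
  Adj p q := p.1 ≠ q.1 ∧ (p.1 ∈ I ∧ p.2 ∈ J) ∧ q.1 ∈ I ∧ q.2 ∈ J
  symm := ⟨fun _ _ h => ⟨h.1.symm, h.2.2, h.2.1⟩⟩
  loopless := ⟨fun _ h => h.1 rfl⟩

omit [DecidableEq α] [DecidableEq β] in
theorem multi_adj {I : Finset α} {J : Finset β} {p q : α × β} :
    (multi I J).Adj p q ↔ p.1 ≠ q.1 ∧ (p.1 ∈ I ∧ p.2 ∈ J) ∧ q.1 ∈ I ∧ q.2 ∈ J := Iff.rfl

omit [DecidableEq α] [DecidableEq β] in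
theorem multi_enum {I : Finset α} {J : Finset β} {r m : ℕ} (hr : 0 < r) (hm : 0 < m)
    (hI : #I = r) (hJ : #J = m) : ∃ φ : ℕ → α × β, Set.InjOn φ (Set.Iio (r * m)) ∧
      (∀ x y, (multi I J).Adj x y → ∃ i < r * m, φ i = x) ∧
      ∀ i < r * m, ∀ j < r * m, i < j → ((multi I J).Adj (φ i) (φ j) ↔ i / m ≠ j / m) := by
  obtain ⟨x, hx, hX⟩ := exists_enum hr hI
  obtain ⟨y, hy, hY⟩ := exists_enum hm hJ
  have hdiv : ∀ i < r * m, i / m < r := fun i hi => Nat.div_lt_of_lt_mul (by rwa [mul_comm])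
  have hmod : ∀ i, i % m < m := fun i => Nat.mod_lt _ hm
  refine ⟨fun i => (x (i / m), y (i % m)), fun i hi j hj h => ?_, fun p q h => ?_,
    fun i hi j hj _ => ?_⟩
  · have h₁ := hx (hdiv i hi) (hdiv j hj) (congrArg Prod.fst h)
    have h₂ := hy (hmod i) (hmod j) (congrArg Prod.snd h)
    rw [← Nat.div_add_mod i m, h₁, h₂, Nat.div_add_mod]
  · obtain ⟨-, ⟨h₁, h₂⟩, -⟩ := h
    obtain ⟨i, hi, h₁⟩ := (hX _).1 h₁
    obtain ⟨j, hj, h₂⟩ := (hY _).1 h₂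
    refine ⟨m * i + j, ?_, ?_⟩
    · calc m * i + j < m * i + m := by lia
        _ = m * (i + 1) := by ring
        _ ≤ m * r := Nat.mul_le_mul_left _ hi
        _ = r * m := mul_comm _ _
    · simp only [Nat.mul_add_div hm, Nat.div_eq_of_lt hj, add_zero, Nat.mul_add_mod,
        Nat.mod_eq_of_lt hj, h₁, h₂]
  · have hm' : ∀ i < r * m, x (i / m) ∈ I ∧ y (i % m) ∈ J := fun i hi =>
      ⟨(hX _).2 ⟨_, hdiv i hi, rfl⟩, (hY _).2 ⟨_, hmod i, rfl⟩⟩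
    simp only [multi_adj, ne_eq, hx.eq_iff (hdiv i hi) (hdiv j hj), hm' i hi, hm' j hj, and_true]

theorem isDegreeMagic_multi_of_list {I : Finset α} {J : Finset β} {r m : ℕ} (hr : 0 < r)
    (hm : 0 < m) (hI : #I = r) (hJ : #J = m) {L : List (ℕ × ℕ)} (hne : 0 < L.length)
    (hL : IsMagicList (r * m) (fun i j => i / m ≠ j / m) L) : IsDegreeMagic (multi I J) := by
  obtain ⟨φ, h₁, h₂, h₃⟩ := multi_enum hr hm hI hJ
  exact hL.isDegreeMagic hne h₁ h₂ h₃

theorem isBalanced_multi_of_list {I : Finset α} {J : Finset β} {r m : ℕ} (hr : 0 < r)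
    (hm : 0 < m) (hI : #I = r) (hJ : #J = m) {L : List (ℕ × ℕ)} (hne : 0 < L.length)
    (hL : IsMagicList (r * m) (fun i j => i / m ≠ j / m) L) (hb : IsBalancedList (r * m) L) :
    IsBalanced (multi I J) := by
  obtain ⟨φ, h₁, h₂, h₃⟩ := multi_enum hr hm hI hJ
  exact hL.isBalanced hb hne h₁ h₂ h₃

theorem isBalanced_multi_of_card_le_one {I : Finset α} {J : Finset β} (hI : #I ≤ 1) :
    IsBalanced (multi I J) := by
  convert isBalanced_bot (V := α × β)
  ext p q
  rw [multi_adj]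
  simp only [SimpleGraph.bot_adj, iff_false]
  rintro ⟨h, ⟨h₁, -⟩, h₂, -⟩
  exact h (Finset.card_le_one.1 hI _ h₁ _ h₂)

omit [DecidableEq α] [DecidableEq β] in
theorem multi_mono {I I' : Finset α} {J J' : Finset β} (hI : I ⊆ I') (hJ : J ⊆ J') :
    multi I J ≤ multi I' J' := fun _ _ h => ⟨h.1, ⟨hI h.2.1.1, hJ h.2.1.2⟩, hI h.2.2.1, hJ h.2.2.2⟩

/-- The edges created by new parts `N` form a multipartite graph on `N` and one old part, and a
bipartite graph between `N` and the other old parts. -/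
theorem isBalanced_multi_union_sdiff {I N : Finset α} {J : Finset β} {i₀ : α} (hi₀ : i₀ ∈ I)
    (hIN : Disjoint I N) (h : IsBalanced (multi (insert i₀ N) J))
    (h' : IsBalanced (bip (N ×ˢ J) (I.erase i₀ ×ˢ J))) :
    IsBalanced (multi (I ∪ N) J \ multi I J) := by
  have hIN' : ∀ a, a ∈ I → a ∉ N :=
    fun _ h => Finset.disjoint_left.1 hIN h
  have heq : multi (I ∪ N) J \ multi I J =
      multi (insert i₀ N) J ⊔ bip (N ×ˢ J) (I.erase i₀ ×ˢ J) := by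
    ext ⟨a, s⟩ ⟨b, t⟩
    simp only [SimpleGraph.sdiff_adj, SimpleGraph.sup_adj, multi_adj, bip_adj, Finset.mem_union,
      Finset.mem_insert, Finset.mem_product, Finset.mem_erase, ne_eq, Prod.mk.injEq]
    have := hIN' a; have := hIN' b
    grind
  rw [heq]
  refine h.sup h' (SimpleGraph.disjoint_left.2 ?_)
  rintro ⟨a, s⟩ ⟨b, t⟩
  simp only [multi_adj, bip_adj, Finset.mem_insert, Finset.mem_product, Finset.mem_erase, ne_eq,
    Prod.mk.injEq]
  have := hIN' a; have := hIN' b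
  grind

/-- The graph joining each vertex of `K × J'` to the vertices of `I × J` with a different first
coordinate. -/
def cross (K I : Finset α) (J' J : Finset β) : SimpleGraph (α × β) where
  Adj p q := p.1 ≠ q.1 ∧ ((p.1 ∈ K ∧ p.2 ∈ J') ∧ q.1 ∈ I ∧ q.2 ∈ J ∨
    (q.1 ∈ K ∧ q.2 ∈ J') ∧ p.1 ∈ I ∧ p.2 ∈ J)
  symm := ⟨fun _ _ h => ⟨h.1.symm, h.2.symm⟩⟩
  loopless := ⟨fun _ h => h.1 rfl⟩

omit [DecidableEq α] [DecidableEq β] in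
theorem cross_adj {K I : Finset α} {J' J : Finset β} {p q : α × β} :
    (cross K I J' J).Adj p q ↔ p.1 ≠ q.1 ∧ ((p.1 ∈ K ∧ p.2 ∈ J') ∧ q.1 ∈ I ∧ q.2 ∈ J ∨
      (q.1 ∈ K ∧ q.2 ∈ J') ∧ p.1 ∈ I ∧ p.2 ∈ J) := Iff.rfl

theorem isBalanced_cross {I : Finset α} {J' J : Finset β} (hJ : Disjoint J' J)
    (h : ∀ i ∈ I, IsBalanced (bip ({i} ×ˢ J') (I.erase i ×ˢ J))) {K : Finset α} (hK : K ⊆ I) :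
    IsBalanced (cross K I J' J) := by
  have hJ' : ∀ a, a ∈ J' → a ∉ J :=
    fun _ h => Finset.disjoint_left.1 hJ h
  induction K using Finset.induction_on with
  | empty =>
    convert isBalanced_bot (V := α × β)
    ext p q
    simp [cross_adj]
  | insert i K hi ih =>
    rw [Finset.insert_subset_iff] at hK
    have heq : cross (insert i K) I J' J = cross K I J' J ⊔ bip ({i} ×ˢ J') (I.erase i ×ˢ J) := by
      ext ⟨a, s⟩ ⟨b, t⟩
      simp only [SimpleGraph.sup_adj, cross_adj, bip_adj, Finset.mem_insert, Finset.mem_product,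
        Finset.mem_erase, Finset.mem_singleton, ne_eq, Prod.mk.injEq]
      grind
    rw [heq]
    refine (ih hK.2).sup (h i hK.1) (SimpleGraph.disjoint_left.2 ?_)
    rintro ⟨a, s⟩ ⟨b, t⟩
    simp only [cross_adj, bip_adj, Finset.mem_product, Finset.mem_erase, Finset.mem_singleton,
      ne_eq, Prod.mk.injEq]
    have := hJ' s; have := hJ' t
    grind

/-- The edges created by enlarging every part by `J'`. -/
theorem isBalanced_multi_sdiff_of_bip {I : Finset α} {J' J : Finset β} (hJ : Disjoint J' J)
    (h : IsBalanced (multi I J'))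
    (h' : ∀ i ∈ I, IsBalanced (bip ({i} ×ˢ J') (I.erase i ×ˢ J))) :
    IsBalanced (multi I (J ∪ J') \ multi I J) := by
  have hJ' : ∀ a, a ∈ J' → a ∉ J :=
    fun _ h => Finset.disjoint_left.1 hJ h
  have heq : multi I (J ∪ J') \ multi I J = multi I J' ⊔ cross I I J' J := by
    ext ⟨a, s⟩ ⟨b, t⟩
    simp only [SimpleGraph.sdiff_adj, SimpleGraph.sup_adj, multi_adj, cross_adj, Finset.mem_union]
    have := hJ' s; have := hJ' t
    grind
  rw [heq]
  refine h.sup (isBalanced_cross hJ h' subset_rfl) (SimpleGraph.disjoint_left.2 ?_)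
  rintro ⟨a, s⟩ ⟨b, t⟩
  simp only [multi_adj, cross_adj]
  have := hJ' s; have := hJ' t
  grind

end Multipartite

/-! ### Regular complete multipartite graphs with large parts -/

section Families

variable {α β : Type*} [DecidableEq α] [DecidableEq β]

theorem isBalanced_multi_of_even {I : Finset α} {J : Finset β} (hJ : Even #J) (hJ4 : 4 ≤ #J) :
    IsBalanced (multi I J) := by
  induction I using Finset.induction_on with
  | empty => exact isBalanced_multi_of_card_le_one (by simp)
  | insert i I hi ih =>
    have heq : multi (insert i I) J = multi I J ⊔ bip ({i} ×ˢ J) (I ×ˢ J) := by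
      ext ⟨a, s⟩ ⟨b, t⟩
      simp only [SimpleGraph.sup_adj, multi_adj, bip_adj, Finset.mem_insert, Finset.mem_product,
        Finset.mem_singleton, ne_eq, Prod.mk.injEq]
      grind
    rw [heq]
    refine ih.sup (isBalanced_bip ?_ ?_ ?_ ?_) (SimpleGraph.disjoint_left.2 ?_)
    · rw [Finset.disjoint_left]
      rintro ⟨a, s⟩
      simp only [Finset.mem_product, Finset.mem_singleton]
      rintro ⟨rfl, -⟩ ⟨h, -⟩
      exact hi h
    · simpa using hJ
    · rw [Finset.card_product]
      exact hJ.mul_left _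
    · rw [Finset.card_product, Finset.card_product, Finset.card_singleton, one_mul]
      rw [Nat.even_iff] at hJ
      rcases Nat.eq_zero_or_pos #I with h0 | h0
      · exact Or.inr (Or.inl (by simp [h0]))
      · have := Nat.le_mul_of_pos_left #J h0
        lia
    · rintro ⟨a, s⟩ ⟨b, t⟩
      simp only [multi_adj, bip_adj, Finset.mem_product, Finset.mem_singleton, ne_eq,
        Prod.mk.injEq]
      grind

/-- The edges lost when `c` parts are removed from a complete multipartite graph form a balanced
graph, provided that `c + 1` parts alone give a balanced graph and the sizes are suitable. -/
theorem exists_isBalanced_multi_sdiff {I : Finset α} {J : Finset β} {c k : ℕ} (hk : 1 ≤ k)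
    (hI : #I = k + c) (h : ∀ I' : Finset α, #I' = c + 1 → IsBalanced (multi I' J))
    (hc : 4 ∣ c * #J) (hkJ : Even ((k - 1) * #J)) :
    ∃ I' ⊆ I, #I' = k ∧ IsBalanced (multi I J \ multi I' J) := by
  obtain ⟨I', hI', hc'⟩ := Finset.exists_subset_card_eq (s := I) (n := k) (by lia)
  obtain ⟨i₀, hi₀⟩ := Finset.card_pos.1 (show 0 < #I' by lia)
  have hd : Disjoint I' (I \ I') := Finset.disjoint_sdiff
  have hi₀' : i₀ ∉ I \ I' := fun h => (Finset.mem_sdiff.1 h).2 hi₀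
  have hcs : #(I \ I') = c := by rw [Finset.card_sdiff_of_subset hI']; lia
  refine ⟨I', hI', hc', ?_⟩
  have hu : I' ∪ I \ I' = I := Finset.union_sdiff_of_subset hI'
  have := isBalanced_multi_union_sdiff (J := J) hi₀ hd
    (h _ (by rw [Finset.card_insert_of_notMem hi₀', hcs])) (isBalanced_bip ?_ ?_ ?_ ?_)
  · rwa [hu] at this
  · exact Finset.disjoint_product.2 (Or.inl (hd.symm.mono_right (Finset.erase_subset _ _)))
  · rw [Finset.card_product, hcs]
    exact even_iff_two_dvd.2 (dvd_trans (by norm_num) hc)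
  · rwa [Finset.card_product, Finset.card_erase_of_mem hi₀, hc']
  · rw [Finset.card_product, hcs]
    exact Or.inl hc

theorem isBalanced_multi_two {I : Finset α} {J : Finset β} (hI : 3 ≤ #I) (hJ : #J = 2) :
    IsBalanced (multi I J) := by
  have h3 : ∀ I' : Finset α, #I' = 2 + 1 → IsBalanced (multi I' J) := fun I' hI' =>
    isBalanced_multi_of_list (by lia) (by lia) hI' hJ (by decide) isMagicList_listMulti23
      isBalancedList_listMulti23
  induction hn : #I using Nat.strong_induction_on generalizing I with
  | _ n ih =>
    subst hn
    by_cases h : #I = 3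
    · exact h3 I h
    by_cases h' : #I = 4
    · exact isBalanced_multi_of_list (by lia) (by lia) h' hJ (by decide) isMagicList_listMulti24
        isBalancedList_listMulti24
    obtain ⟨I', hI', hc, hb⟩ := exists_isBalanced_multi_sdiff (I := I) (J := J) (c := 2)
      (k := #I - 2) (by lia) (by lia) h3 (by rw [hJ]) (by rw [hJ]; exact even_two.mul_left _)
    exact IsBalanced.of_sdiff (multi_mono hI' subset_rfl) (ih _ (by lia) (by lia) rfl) hb

/-- Enlarging all parts of a complete multipartite graph. -/
theorem exists_isBalanced_multi_sdiff_of_card {I : Finset α} {J : Finset β} {c k : ℕ}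
    (hJ : #J = k + c) (h : ∀ J' : Finset β, #J' = c → IsBalanced (multi I J'))
    (hev : Even c) (hb : 4 ∣ c ∨ 4 ∣ (#I - 1) * k) (hk : Even ((#I - 1) * k)) :
    ∃ J' ⊆ J, #J' = k ∧ IsBalanced (multi I J \ multi I J') := by
  obtain ⟨J', hJ', hc'⟩ := Finset.exists_subset_card_eq (s := J) (n := k) (by lia)
  have hcs : #(J \ J') = c := by rw [Finset.card_sdiff_of_subset hJ']; lia
  refine ⟨J', hJ', hc', ?_⟩
  have hd : Disjoint (J \ J') J' := Finset.sdiff_disjoint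
  have := isBalanced_multi_sdiff_of_bip hd (h _ hcs) fun i hi => isBalanced_bip ?_ ?_ ?_ ?_
  · rwa [Finset.union_sdiff_of_subset hJ'] at this
  · exact Finset.disjoint_product.2 (Or.inr hd)
  · rwa [Finset.card_product, Finset.card_singleton, one_mul, hcs]
  · rwa [Finset.card_product, Finset.card_erase_of_mem hi, hc']
  · rw [Finset.card_product, Finset.card_product, Finset.card_erase_of_mem hi, hc', hcs,
      Finset.card_singleton, one_mul]
    tauto

theorem isBalanced_multi_five {I : Finset α} {J : Finset β} (hI : #I = 5) (hJ : Odd #J)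
    (hJ3 : 3 ≤ #J) : IsBalanced (multi I J) := by
  rw [Nat.odd_iff] at hJ
  induction hn : #J using Nat.strong_induction_on generalizing J with
  | _ n ih =>
    subst hn
    by_cases h : #J = 3
    · exact isBalanced_multi_of_list (by lia) (by lia) hI h (by decide) isMagicList_listMulti35
        isBalancedList_listMulti35
    obtain ⟨J', hJ', hc, hb⟩ := exists_isBalanced_multi_sdiff_of_card (I := I) (J := J) (c := 2)
      (k := #J - 2) (by lia) (fun J' hJ' => isBalanced_multi_two (by lia) hJ') even_two
      (Or.inr (by rw [hI]; lia)) (by rw [hI, Nat.even_iff]; lia)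
    exact IsBalanced.of_sdiff (multi_mono subset_rfl hJ') (ih _ (by lia) (by lia) (by lia) rfl) hb

theorem isBalanced_multi_of_one_mod_four {I : Finset α} {J : Finset β} (hI : #I % 4 = 1)
    (hJ : Odd #J) (hJ3 : 3 ≤ #J) : IsBalanced (multi I J) := by
  induction hn : #I using Nat.strong_induction_on generalizing I with
  | _ n ih =>
    subst hn
    by_cases h : #I = 1
    · exact isBalanced_multi_of_card_le_one h.le
    obtain ⟨I', hI', hc, hb⟩ := exists_isBalanced_multi_sdiff (I := I) (J := J) (c := 4)
      (k := #I - 4) (by lia) (by lia) (fun I' hI' => isBalanced_multi_five hI' hJ hJ3) (by lia)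
      (Even.mul_right (by rw [Nat.even_iff]; lia) _)
    exact IsBalanced.of_sdiff (multi_mono hI' subset_rfl) (ih _ (by lia) (by lia) rfl) hb

theorem isDegreeMagic_multi_three {I : Finset α} {J : Finset β} (hI : #I = 3) (hJ : Odd #J)
    (hJ3 : 3 ≤ #J) : IsDegreeMagic (multi I J) := by
  rw [Nat.odd_iff] at hJ
  induction hn : #J using Nat.strong_induction_on generalizing J with
  | _ n ih =>
    subst hn
    by_cases h : #J = 3
    · exact isDegreeMagic_multi_of_list (by lia) (by lia) hI h (by decide) isMagicList_listMulti33
    by_cases h' : #J = 5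
    · exact isDegreeMagic_multi_of_list (by lia) (by lia) hI h' (by decide) isMagicList_listMulti53
    obtain ⟨J', hJ', hc, hb⟩ := exists_isBalanced_multi_sdiff_of_card (I := I) (J := J) (c := 4)
      (k := #J - 4) (by lia) (fun J' hJ' => isBalanced_multi_of_even (by rw [hJ']; decide) hJ'.ge)
      (by decide) (Or.inl dvd_rfl) (by rw [hI, Nat.even_iff]; lia)
    exact IsDegreeMagic.of_sdiff (multi_mono subset_rfl hJ')
      (ih _ (by lia) (by lia) (by lia) rfl) hb

theorem isDegreeMagic_multi_of_odd {I : Finset α} {J : Finset β} (hI : Odd #I) (hJ : Odd #J)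
    (hJ3 : 3 ≤ #J) : IsDegreeMagic (multi I J) := by
  rw [Nat.odd_iff] at hI
  induction hn : #I using Nat.strong_induction_on generalizing I with
  | _ n ih =>
    subst hn
    by_cases h : #I = 1
    · exact (isBalanced_multi_of_card_le_one h.le).isDegreeMagic
    by_cases h' : #I = 3
    · exact isDegreeMagic_multi_three h' hJ hJ3
    obtain ⟨I', hI', hc, hb⟩ := exists_isBalanced_multi_sdiff (I := I) (J := J) (c := 4)
      (k := #I - 4) (by lia) (by lia) (fun I' hI' => isBalanced_multi_five hI' hJ hJ3) (by lia)
      (Even.mul_right (by rw [Nat.even_iff]; lia) _)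
    exact IsDegreeMagic.of_sdiff (multi_mono hI' subset_rfl) (ih _ (by lia) (by lia) rfl) hb

end Families

/-! ### Magic rectangles -/

theorem two_mul_sum_of_injOn {m : ℕ} {g : ℕ → ℕ} (hg : ∀ j < m, g j < m)
    (hinj : Set.InjOn g (Set.Iio m)) : 2 * ∑ j ∈ range m, (g j : ℤ) = m * (m - 1) := by
  have hinj' : Set.InjOn g (range m) := by rwa [Finset.coe_range]
  have himg : (range m).image g = range m := by
    refine Finset.eq_of_subset_of_card_le ?_ (by rw [Finset.card_image_of_injOn hinj'])
    intro x hx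
    obtain ⟨j, hj, rfl⟩ := Finset.mem_image.1 hx
    exact Finset.mem_range.2 (hg j (Finset.mem_range.1 hj))
  have hgauss : ∀ n : ℕ, 2 * ∑ j ∈ range n, (j : ℤ) = n * (n - 1) := by
    intro n
    induction n with
    | zero => simp
    | succ n ih => rw [Finset.sum_range_succ, mul_add, ih]; push_cast; ring
  rw [← hgauss m]
  conv_rhs => rw [← himg, Finset.sum_image hinj']

/-- A Kotzig array with columns indexed by `k < t` (`t` odd): each row is a permutation of
`0, …, t - 1`, the first three rows have constant column sums, and so do the later pairs. -/
def kotzig (t i k : ℕ) : ℕ :=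
  if i = 0 then k
  else if i = 1 then if k < t / 2 then k + t / 2 + 1 else k - t / 2
  else if i = 2 then if k < t / 2 then t - 2 - 2 * k else 2 * t - 2 - 2 * k
  else if i % 2 = 1 then k else t - 1 - k

theorem kotzig_lt {t : ℕ} (ht : t % 2 = 1) (i : ℕ) {k : ℕ} (hk : k < t) : kotzig t i k < t := by
  unfold kotzig
  split_ifs <;> lia

theorem kotzig_injOn {t : ℕ} (ht : t % 2 = 1) (i : ℕ) : Set.InjOn (kotzig t i) (Set.Iio t) := by
  intro k hk l hl h
  rw [Set.mem_Iio] at hk hl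
  unfold kotzig at h
  split_ifs at h <;> lia

theorem sum_kotzig {t : ℕ} (ht : t % 2 = 1) {k : ℕ} (hk : k < t) (M : ℕ) :
    2 * ∑ i ∈ range (2 * M + 3), (kotzig t i k : ℤ) = (2 * M + 3 : ℕ) * (t - 1) := by
  induction M with
  | zero =>
    have : kotzig t 0 k + kotzig t 1 k + kotzig t 2 k = 3 * (t / 2) := by
      simp only [kotzig]
      split_ifs <;> lia
    have h2 : 2 * (3 * (t / 2)) = 3 * (t - 1) := by lia
    simp only [Finset.sum_range_succ, Finset.sum_range_zero, mul_zero, zero_add]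
    zify [show 1 ≤ t by lia] at this h2
    push_cast
    rw [this]
    lia
  | succ M ih =>
    have : kotzig t (2 * M + 3) k + kotzig t (2 * M + 4) k = t - 1 := by
      unfold kotzig
      split_ifs <;> lia
    zify [show 1 ≤ t by lia] at this
    rw [show 2 * (M + 1) + 3 = 2 * M + 3 + 1 + 1 by ring, Finset.sum_range_succ,
      Finset.sum_range_succ, add_assoc, mul_add, ih, show 2 * M + 3 + 1 = 2 * M + 4 by ring, this]
    push_cast
    ring

/-- The entry in row `i` and column `(k, j)` of an `m × t m` magic rectangle (`m ≥ 3` and `t` odd):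
the leading digits form `t` copies of an odd magic square, and the last digit, in base `t`, is taken
from a Kotzig array. -/
def rectEntry (m t i k j : ℕ) : ℕ :=
  t * (m * ((i + j) % m) + (i + (m - j)) % m) + kotzig t i k

section Rectangle

variable {m t : ℕ}

theorem add_mod_injOn (m a : ℕ) : Set.InjOn (fun j => (a + j) % m) (Set.Iio m) := by
  intro i hi j hj h
  rw [Set.mem_Iio] at hi hj
  have : i ≡ j [MOD m] := Nat.ModEq.add_left_cancel' a h
  rwa [Nat.ModEq, Nat.mod_eq_of_lt hi, Nat.mod_eq_of_lt hj] at this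

theorem add_sub_mod_injOn (m a : ℕ) : Set.InjOn (fun j => (a + (m - j)) % m) (Set.Iio m) := by
  intro i hi j hj h
  rw [Set.mem_Iio] at hi hj
  have h₁ : m - i ≡ m - j [MOD m] := Nat.ModEq.add_left_cancel' a h
  have h₂ := (h₁.add_right (i + j))
  rw [show m - i + (i + j) = j + m by lia, show m - j + (i + j) = i + m by lia, Nat.ModEq,
    Nat.add_mod_right, Nat.add_mod_right, Nat.mod_eq_of_lt hi, Nat.mod_eq_of_lt hj] at h₂
  exact h₂.symm

theorem rectEntry_lt (ht : t % 2 = 1) (hm : 0 < m) (i j : ℕ) {k : ℕ} (hk : k < t) :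
    rectEntry m t i k j < m * m * t := by
  have h₁ := kotzig_lt ht i hk
  have h₂ := Nat.mod_lt (i + j) hm
  have h₃ := Nat.mod_lt (i + (m - j)) hm
  have h₄ : m * ((i + j) % m) + (i + (m - j)) % m < m * m := by nlinarith
  unfold rectEntry
  nlinarith

theorem rectEntry_inj (hm : m % 2 = 1) (ht : t % 2 = 1) {i k j i' k' j' : ℕ} (hi : i < m)
    (hk : k < t) (hj : j < m) (hi' : i' < m) (hk' : k' < t) (hj' : j' < m)
    (h : rectEntry m t i k j = rectEntry m t i' k' j') : i = i' ∧ k = k' ∧ j = j' := by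
  have hm0 : 0 < m := by lia
  have ht0 : 0 < t := by lia
  have digits : ∀ {b x y x' y' : ℕ}, y < b → y' < b → b * x + y = b * x' + y' →
      x = x' ∧ y = y' := by
    intro b x y x' y' hy hy' h
    have hb : 0 < b := by lia
    have h₁ := congrArg (· / b) h
    have h₂ := congrArg (· % b) h
    simp only [Nat.mul_add_div hb, Nat.div_eq_of_lt hy, Nat.div_eq_of_lt hy', Nat.mul_add_mod,
      Nat.mod_eq_of_lt hy, Nat.mod_eq_of_lt hy', add_zero] at h₁ h₂
    exact ⟨h₁, h₂⟩
  obtain ⟨h₁, h₂⟩ := digits (kotzig_lt ht i hk) (kotzig_lt ht i' hk') h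
  obtain ⟨h₃, h₄⟩ := digits (Nat.mod_lt _ hm0) (Nat.mod_lt _ hm0) h₁
  -- The sum and the difference of `i` and `j` modulo the odd number `m` determine both.
  have h₅ : 2 * i ≡ 2 * i' [MOD m] := by
    have := Nat.ModEq.add (show i + j ≡ i' + j' [MOD m] from h₃)
      (show i + (m - j) ≡ i' + (m - j') [MOD m] from h₄)
    rw [show i + j + (i + (m - j)) = 2 * i + m by lia,
      show i' + j' + (i' + (m - j')) = 2 * i' + m by lia] at this
    exact Nat.ModEq.add_right_cancel' m this
  have h₆ : i = i' := by
    have := Nat.ModEq.cancel_left_of_coprime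
      (Nat.coprime_two_right.2 (Nat.odd_iff.2 hm) : Nat.gcd m 2 = 1) h₅
    rwa [Nat.ModEq, Nat.mod_eq_of_lt hi, Nat.mod_eq_of_lt hi'] at this
  subst h₆
  exact ⟨rfl, kotzig_injOn ht i hk hk' h₂, add_mod_injOn m i hj hj' h₃⟩

theorem sum_rectEntry_row (ht : t % 2 = 1) (hm : 0 < m) (i : ℕ) :
    ∑ k ∈ range t, ∑ j ∈ range m, (2 * (rectEntry m t i k j : ℤ) + 1 - (m * m * t : ℕ)) = 0 := by
  have h₁ := two_mul_sum_of_injOn (fun j _ => Nat.mod_lt _ hm) (add_mod_injOn m i)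
  have h₂ := two_mul_sum_of_injOn (fun j _ => Nat.mod_lt _ hm) (add_sub_mod_injOn m i)
  have h₃ := two_mul_sum_of_injOn (fun k hk => kotzig_lt ht i hk) (kotzig_injOn ht i)
  have hin : ∀ k, ∑ j ∈ range m, (2 * (rectEntry m t i k j : ℤ) + 1 - (m * m * t : ℕ)) =
      m * (2 * kotzig t i k + 1 - t) := by
    intro k
    have hconst : ∀ c : ℤ, m * c = ∑ _j ∈ range m, c := by simp
    calc _ = t * m * (2 * ∑ j ∈ range m, (((i + j) % m : ℕ) : ℤ)) +
          t * (2 * ∑ j ∈ range m, (((i + (m - j)) % m : ℕ) : ℤ)) +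
          m * (2 * kotzig t i k + 1 - m * m * t) := by
          simp only [rectEntry, Finset.mul_sum, ← Finset.sum_add_distrib]
          rw [hconst, ← Finset.sum_add_distrib]
          refine Finset.sum_congr rfl fun j _ => ?_
          push_cast
          ring
      _ = _ := by rw [h₁, h₂]; ring
  calc _ = m * (2 * ∑ k ∈ range t, (kotzig t i k : ℤ) + ∑ k ∈ range t, (1 - t : ℤ)) := by
        simp only [hin, Finset.mul_sum, ← Finset.sum_add_distrib]
        exact Finset.sum_congr rfl fun k _ => by ring
    _ = 0 := by
        rw [h₃, Finset.sum_const, Finset.card_range, nsmul_eq_mul]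
        ring

theorem sum_rectEntry_col (hm : m % 2 = 1) (hm3 : 3 ≤ m) (ht : t % 2 = 1) {k : ℕ} (hk : k < t)
    (j : ℕ) :
    ∑ i ∈ range m, (2 * (rectEntry m t i k j : ℤ) + 1 - (m * m * t : ℕ)) = 0 := by
  have hm0 : 0 < m := by lia
  have h₁ := two_mul_sum_of_injOn (fun i _ => Nat.mod_lt _ hm0) (add_mod_injOn m j)
  have h₂ := two_mul_sum_of_injOn (fun i _ => Nat.mod_lt _ hm0) (add_mod_injOn m (m - j))
  have h₃ := sum_kotzig ht hk ((m - 3) / 2)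
  rw [show 2 * ((m - 3) / 2) + 3 = m by lia] at h₃
  have hconst : ∀ c : ℤ, m * c = ∑ _i ∈ range m, c := by simp
  calc _ = t * m * (2 * ∑ i ∈ range m, (((j + i) % m : ℕ) : ℤ)) +
        t * (2 * ∑ i ∈ range m, (((m - j + i) % m : ℕ) : ℤ)) +
        2 * ∑ i ∈ range m, (kotzig t i k : ℤ) + m * (1 - m * m * t) := by
        simp only [rectEntry, Finset.mul_sum, ← Finset.sum_add_distrib]
        rw [hconst, ← Finset.sum_add_distrib]
        refine Finset.sum_congr rfl fun i _ => ?_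
        rw [add_comm i j, add_comm i (m - j)]
        push_cast
        ring
    _ = _ := by rw [h₁, h₂, h₃]; ring

end Rectangle

section OddParts

variable {α β : Type*} [DecidableEq α] [DecidableEq β]

theorem isDegreeMagic_bip_rect {i₀ : α} {I : Finset α} {J : Finset β} (hi₀ : i₀ ∉ I) (hI : Odd #I)
    (hJ : Odd #J) (hJ3 : 3 ≤ #J) : IsDegreeMagic (bip ({i₀} ×ˢ J) (I ×ˢ J)) := by
  rw [Nat.odd_iff] at hI hJ
  obtain ⟨m, hm⟩ : ∃ m, #J = m := ⟨_, rfl⟩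
  obtain ⟨t, ht⟩ : ∃ t, #I = t := ⟨_, rfl⟩
  rw [hm] at hJ hJ3
  rw [ht] at hI
  obtain ⟨a, ha, haI⟩ := exists_enum (show 0 < t by lia) ht
  obtain ⟨b, hb, hbJ⟩ := exists_enum (show 0 < m by lia) hm
  have haI' : ∀ k < t, a k ∈ I := fun k hk => (haI _).2 ⟨k, hk, rfl⟩
  have hbJ' : ∀ j < m, b j ∈ J := fun j hj => (hbJ _).2 ⟨j, hj, rfl⟩
  have hai : ∀ k < t, a k ≠ i₀ := fun k hk h => hi₀ (h ▸ haI' k hk)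
  let T : Finset (ℕ × ℕ × ℕ) := range m ×ˢ range t ×ˢ range m
  let e : ℕ × ℕ × ℕ → (α × β) × (α × β) := fun q => ((i₀, b q.1), (a q.2.1, b q.2.2))
  have hT : ∀ q : ℕ × ℕ × ℕ, q ∈ T ↔ q.1 < m ∧ q.2.1 < t ∧ q.2.2 < m := by simp [T]
  have hTc : #T = m * m * t := by
    simp only [T, Finset.card_product, Finset.card_range]
    ring
  have he : Set.InjOn e T := by
    intro p hp q hq h
    have hp := (hT p).1 hp
    have hq := (hT q).1 hq
    simp only [e, Prod.mk.injEq, true_and] at h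
    exact Prod.ext (hb hp.1 hq.1 h.1) (Prod.ext (ha hp.2.1 hq.2.1 h.2.1) (hb hp.2.2 hq.2.2 h.2.2))
  refine ⟨T.image e, _, ⟨?_, ?_⟩, isCentredLabeling_image he
    (l := fun q => 2 * (rectEntry m t q.1 q.2.1 q.2.2 : ℤ) + 1 - (m * m * t : ℕ)) ?_ ?_ ?_ ?_⟩
  · have key : ∀ x y : α × β, (x, y) ∈ T.image e ↔ x ∈ {i₀} ×ˢ J ∧ y ∈ I ×ˢ J := by
      rintro ⟨x₁, x₂⟩ ⟨y₁, y₂⟩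
      simp only [Finset.mem_image, Finset.mem_product, Finset.mem_singleton]
      constructor
      · rintro ⟨q, hq, h⟩
        have hq := (hT q).1 hq
        simp only [e, Prod.mk.injEq] at h
        obtain ⟨⟨rfl, rfl⟩, rfl, rfl⟩ := h
        exact ⟨⟨rfl, hbJ' _ hq.1⟩, haI' _ hq.2.1, hbJ' _ hq.2.2⟩
      · rintro ⟨⟨rfl, h₁⟩, h₂, h₃⟩
        obtain ⟨i, hi, rfl⟩ := (hbJ _).1 h₁
        obtain ⟨k, hk, rfl⟩ := (haI _).1 h₂
        obtain ⟨j, hj, rfl⟩ := (hbJ _).1 h₃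
        exact ⟨(i, k, j), (hT _).2 ⟨hi, hk, hj⟩, rfl⟩
    intro x y
    rw [key, key, bip_adj]
    have : x ∈ {i₀} ×ˢ J → y ∈ I ×ˢ J → x ≠ y := by
      rintro h₁ h₂ rfl
      rw [Finset.mem_product, Finset.mem_singleton] at h₁
      rw [Finset.mem_product, h₁.1] at h₂
      exact hi₀ h₂.1
    have : x ∈ I ×ˢ J → y ∈ {i₀} ×ˢ J → x ≠ y := by
      rintro h₁ h₂ rfl
      rw [Finset.mem_product, Finset.mem_singleton] at h₂
      rw [Finset.mem_product, h₂.1] at h₁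
      exact hi₀ h₁.1
    tauto
  · intro x y h h'
    obtain ⟨p, hp, hp'⟩ := Finset.mem_image.1 h
    obtain ⟨q, hq, hq'⟩ := Finset.mem_image.1 h'
    simp only [e, Prod.mk.injEq] at hp' hq'
    refine hai q.2.1 ((hT q).1 hq).2.1 ?_
    exact (congrArg Prod.fst hq'.2).trans (congrArg Prod.fst hp'.1).symm
  · intro p hp q hq h
    have hp := (hT p).1 hp
    have hq := (hT q).1 hq
    have h' : rectEntry m t p.1 p.2.1 p.2.2 = rectEntry m t q.1 q.2.1 q.2.2 := by
      simpa using h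
    obtain ⟨h₁, h₂, h₃⟩ := rectEntry_inj hJ hI hp.1 hp.2.1 hp.2.2 hq.1 hq.2.1 hq.2.2 h'
    exact Prod.ext h₁ (Prod.ext h₂ h₃)
  · intro q hq
    have := rectEntry_lt hI (show 0 < m by lia) q.1 q.2.2 ((hT q).1 hq).2.1
    rw [hTc, abs_lt]
    constructor <;> lia
  · intro q hq
    rw [hTc]
    exact ⟨rectEntry m t q.1 q.2.1 q.2.2, by ring⟩
  · rintro ⟨v₁, v₂⟩
    by_cases hv : v₁ = i₀
    · have : ∀ q ∈ T, ((e q).1 = (v₁, v₂) ∨ (e q).2 = (v₁, v₂)) ↔ b q.1 = v₂ := by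
        intro q hq
        have := hai q.2.1 ((hT q).1 hq).2.1
        simp only [e, Prod.mk.injEq, hv, true_and, this, false_and, or_false]
      rw [Finset.sum_congr rfl fun q hq => by rw [if_congr (this q hq) rfl rfl],
        Finset.sum_product]
      refine Finset.sum_eq_zero fun i _ => ?_
      rw [Finset.sum_product]
      by_cases h : b i = v₂
      · simpa [h] using sum_rectEntry_row hI (show 0 < m by lia) i
      · simp [h]
    · have : ∀ q ∈ T, ((e q).1 = (v₁, v₂) ∨ (e q).2 = (v₁, v₂)) ↔
          (a q.2.1, b q.2.2) = (v₁, v₂) := by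
        intro q hq
        simp only [e, Prod.mk.injEq, Ne.symm hv, false_and, false_or]
      rw [Finset.sum_congr rfl fun q hq => by rw [if_congr (this q hq) rfl rfl],
        Finset.sum_product_right]
      refine Finset.sum_eq_zero fun q hq => ?_
      by_cases h : (a q.1, b q.2) = (v₁, v₂)
      · have hq := Finset.mem_range.1 (Finset.mem_product.1 hq).1
        simpa [h] using sum_rectEntry_col hJ hJ3 hI hq q.2
      · simp only [h, if_false, Finset.sum_const_zero]

/-- One part is joined to all the others by a magic rectangle; the others form a balanced graph. -/
theorem isDegreeMagic_multi_of_two_mod_four {I : Finset α} {J : Finset β} (hI : #I % 4 = 2)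
    (hJ : Odd #J) (hJ3 : 3 ≤ #J) : IsDegreeMagic (multi I J) := by
  obtain ⟨i₀, hi₀⟩ := Finset.card_pos.1 (show 0 < #I by lia)
  have hc := Finset.card_erase_of_mem hi₀
  have h₀ := Finset.notMem_erase i₀ I
  have h₁ := isBalanced_multi_of_one_mod_four (I := I.erase i₀) (J := J) (by lia) hJ hJ3
  have h₂ := isDegreeMagic_bip_rect (J := J) h₀ (by rw [hc, Nat.odd_iff]; lia) hJ hJ3
  have heq : multi I J = bip ({i₀} ×ˢ J) (I.erase i₀ ×ˢ J) ⊔ multi (I.erase i₀) J := by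
    ext ⟨a, s⟩ ⟨b, t⟩
    simp only [SimpleGraph.sup_adj, multi_adj, bip_adj, Finset.mem_product, Finset.mem_singleton,
      Finset.mem_erase, ne_eq, Prod.mk.injEq]
    grind
  rw [heq]
  refine h₂.sup h₁ (SimpleGraph.disjoint_left.2 ?_)
  rintro ⟨a, s⟩ ⟨b, t⟩
  simp only [multi_adj, bip_adj, Finset.mem_product, Finset.mem_singleton, Finset.mem_erase, ne_eq,
    Prod.mk.injEq]
  grind

end OddParts

/-! ### Complete graphs of odd order -/

section Complete

variable {V : Type*} [DecidableEq V]

/-- The complete graph on the vertex set `X`. -/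
def completeOn (X : Finset V) : SimpleGraph V where
  Adj a b := a ≠ b ∧ a ∈ X ∧ b ∈ X
  symm := ⟨fun _ _ h => ⟨h.1.symm, h.2.symm⟩⟩
  loopless := ⟨fun _ h => h.1 rfl⟩

omit [DecidableEq V] in
theorem completeOn_adj {X : Finset V} {a b : V} :
    (completeOn X).Adj a b ↔ a ≠ b ∧ a ∈ X ∧ b ∈ X := Iff.rfl

theorem isDegreeMagic_completeOn_of_list {X : Finset V} {k : ℕ} (hk : 0 < k) (hX : #X = k)
    {L : List (ℕ × ℕ)} (hne : 0 < L.length) (hL : IsMagicList k (fun i j => i ≠ j) L) :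
    IsDegreeMagic (completeOn X) := by
  obtain ⟨φ, hφ, hmem⟩ := exists_enum hk hX
  refine hL.isDegreeMagic hne hφ (fun x y h => (hmem x).1 h.2.1) fun i hi j hj _ => ?_
  rw [completeOn_adj, hφ.ne_iff hi hj]
  exact and_iff_left ⟨(hmem _).2 ⟨i, hi, rfl⟩, (hmem _).2 ⟨j, hj, rfl⟩⟩

/-- The edges created by four new vertices: they form `K_7` minus a triangle together with a
complete bipartite graph. -/
theorem isBalanced_completeOn_sdiff {Y N : Finset V} (hYN : Disjoint Y N) (hN : #N = 4)
    (hY : Odd #Y) (hY3 : 3 ≤ #Y) : IsBalanced (completeOn (Y ∪ N) \ completeOn Y) := by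
  obtain ⟨T, hT, hTc⟩ := Finset.exists_subset_card_eq hY3
  have hYN' : ∀ a, a ∈ Y → a ∉ N := fun _ h => Finset.disjoint_left.1 hYN h
  have hT' : ∀ a, a ∈ T → a ∈ Y := fun _ h => hT h
  have hNT : Disjoint N T := (hYN.mono_left hT).symm
  obtain ⟨φ, hφ, hmem, hiff⟩ := exists_enum_union hNT (by lia) (by lia) hN hTc
  have h₁ : IsBalanced (completeOn (N ∪ T) \ completeOn T) := by
    refine isMagicList_listCompleteDiff.isBalanced isBalancedList_listCompleteDiff (by decide) hφ
      (fun x y h => (hmem x).1 ?_) fun i hi j hj hij => ?_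
    · exact ((SimpleGraph.sdiff_adj _ _ _ _).1 h).1.2.1
    · have := hφ.ne hi hj hij.ne
      have := hiff i hi
      have := hiff j hj
      simp only [SimpleGraph.sdiff_adj, completeOn_adj, Finset.mem_union]
      grind
  have h₂ : IsBalanced (bip N (Y \ T)) := by
    refine isBalanced_bip (hYN.mono_left Finset.sdiff_subset).symm (by rw [hN]; decide) ?_
      (Or.inl (by rw [hN]))
    rw [Finset.card_sdiff_of_subset hT, hTc]
    exact Nat.Odd.sub_odd hY (by decide)
  have heq : completeOn (Y ∪ N) \ completeOn Y =
      (completeOn (N ∪ T) \ completeOn T) ⊔ bip N (Y \ T) := by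
    ext a b
    simp only [SimpleGraph.sdiff_adj, SimpleGraph.sup_adj, completeOn_adj, bip_adj,
      Finset.mem_union, Finset.mem_sdiff]
    have := hYN' a; have := hYN' b; have := hT' a; have := hT' b
    grind
  rw [heq]
  refine h₁.sup h₂ (SimpleGraph.disjoint_left.2 fun a b => ?_)
  simp only [SimpleGraph.sdiff_adj, completeOn_adj, bip_adj, Finset.mem_union, Finset.mem_sdiff]
  have := hYN' a; have := hYN' b; have := hT' a; have := hT' b
  grind

theorem isDegreeMagic_completeOn_of_odd {X : Finset V} (hX : Odd #X) (hX7 : 7 ≤ #X) :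
    IsDegreeMagic (completeOn X) := by
  induction hn : #X using Nat.strong_induction_on generalizing X with
  | _ n ih =>
    subst hn
    rw [Nat.odd_iff] at hX
    by_cases h : #X = 7
    · exact isDegreeMagic_completeOn_of_list (by lia) h (by decide) isMagicList_listComplete7
    by_cases h' : #X = 9
    · exact isDegreeMagic_completeOn_of_list (by lia) h' (by decide) isMagicList_listComplete9
    obtain ⟨N, hN, hc⟩ := Finset.exists_subset_card_eq (s := X) (n := 4) (by lia)
    have hcs : #(X \ N) = #X - 4 := by rw [Finset.card_sdiff_of_subset hN, hc]
    have hodd : Odd #(X \ N) := by rw [hcs, Nat.odd_iff]; lia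
    have := isBalanced_completeOn_sdiff Finset.sdiff_disjoint hc hodd (by lia)
    rw [Finset.sdiff_union_of_subset hN] at this
    refine IsDegreeMagic.of_sdiff ?_ (ih _ (by lia) hodd (by lia) hcs) this
    exact fun a b h => ⟨h.1, Finset.sdiff_subset h.2.1, Finset.sdiff_subset h.2.2⟩

end Complete

/-! ### Möbius ladders and complete graphs of even order -/

/-- The cyclic successor on `{0, …, s - 1}`. -/
def cyclicSucc (s k : ℕ) : ℕ := if k + 1 = s then 0 else k + 1

/-- The Möbius ladder with `s` rungs (`s` odd), in its bipartite form: `(k, false)` is joined to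
`(k, true)` and to the two cyclic neighbours of `(k, true)`. -/
def ladder (s : ℕ) : SimpleGraph (ℕ × Bool) where
  Adj p q := p.2 ≠ q.2 ∧ p.1 < s ∧ q.1 < s ∧
    (p.1 = q.1 ∨ q.1 = cyclicSucc s p.1 ∨ p.1 = cyclicSucc s q.1)
  symm := ⟨fun _ _ h => ⟨h.1.symm, h.2.2.1, h.2.1, by
    rcases h.2.2.2 with h | h | h <;> simp [h]⟩⟩
  loopless := ⟨fun _ h => h.1 rfl⟩

/-- The complement of the Möbius ladder. -/
def ladderCompl (s : ℕ) : SimpleGraph (ℕ × Bool) := completeOn (range s ×ˢ univ) \ ladder s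

theorem ladder_adj {s : ℕ} {p q : ℕ × Bool} : (ladder s).Adj p q ↔
    p.2 ≠ q.2 ∧ p.1 < s ∧ q.1 < s ∧
      (p.1 = q.1 ∨ q.1 = cyclicSucc s p.1 ∨ p.1 = cyclicSucc s q.1) := Iff.rfl

theorem ladderCompl_adj {s : ℕ} {p q : ℕ × Bool} : (ladderCompl s).Adj p q ↔
    p ≠ q ∧ p.1 < s ∧ q.1 < s ∧
      ¬ (p.2 ≠ q.2 ∧ (p.1 = q.1 ∨ q.1 = cyclicSucc s p.1 ∨ p.1 = cyclicSucc s q.1)) := by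
  simp only [ladderCompl, SimpleGraph.sdiff_adj, completeOn_adj, ladder_adj, Finset.mem_product,
    Finset.mem_range, Finset.mem_univ, and_true]
  tauto

/-- The permutation `0, h, 1, h + 1, 2, …` of `0, …, s - 1` (`s = 2 h - 1`), whose sums of
cyclically consecutive terms are `s` consecutive integers. -/
def zigzag (s k : ℕ) : ℕ := if k % 2 = 0 then k / 2 else (k + s) / 2

/-- The `(k, t)`-th oriented edge of the Möbius ladder: a rung for `t = 0`, a rail otherwise. -/
def ladderEdge (s : ℕ) (q : ℕ × Fin 3) : (ℕ × Bool) × (ℕ × Bool) :=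
  if q.2 = 0 then ((q.1, false), (q.1, true))
  else if q.2 = 1 then ((q.1, false), (cyclicSucc s q.1, true))
  else ((cyclicSucc s q.1, false), (q.1, true))

/-- The labels (counted from `0`) of the edges of the Möbius ladder. -/
def ladderLabel (s : ℕ) (q : ℕ × Fin 3) : ℕ :=
  if q.2 = 0 then if q.1 + 1 = s then 2 * s - 1 else 2 * s - 2 - q.1
  else if q.2 = 1 then zigzag s (cyclicSucc s q.1) + 2 * s
  else zigzag s (cyclicSucc s q.1)

theorem ladder_sum {s k : ℕ} (hs : s % 2 = 1) (hk : k < s) :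
    2 * ((if k + 1 = s then 2 * s - 1 else 2 * s - 2 - k) + (zigzag s (cyclicSucc s k) + 2 * s) +
      zigzag s k) = 9 * s - 3 := by
  unfold zigzag cyclicSucc
  split_ifs <;> lia

theorem cyclicSucc_lt {s k : ℕ} (hk : k < s) : cyclicSucc s k < s := by
  unfold cyclicSucc
  split_ifs <;> lia

theorem cyclicSucc_inj {s k l : ℕ} (h : cyclicSucc s k = cyclicSucc s l) : k = l := by
  unfold cyclicSucc at h
  split_ifs at h <;> lia

theorem exists_cyclicSucc_eq {s k : ℕ} (hk : k < s) : ∃ l < s, cyclicSucc s l = k := by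
  unfold cyclicSucc
  rcases Nat.eq_zero_or_pos k with rfl | h
  · exact ⟨s - 1, by lia, by rw [if_pos (by lia)]⟩
  · exact ⟨k - 1, by lia, by rw [if_neg (by lia)]; lia⟩

theorem zigzag_lt {s k : ℕ} (hs : s % 2 = 1) (hk : k < s) : zigzag s k < s := by
  unfold zigzag
  split_ifs <;> lia

theorem zigzag_inj {s k l : ℕ} (hs : s % 2 = 1) (hk : k < s) (hl : l < s)
    (h : zigzag s k = zigzag s l) : k = l := by
  unfold zigzag at h
  split_ifs at h <;> lia

theorem ladderLabel_inj {s : ℕ} (hs : s % 2 = 1) {k l : ℕ} {t u : Fin 3} (hk : k < s) (hl : l < s)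
    (h : ladderLabel s (k, t) = ladderLabel s (l, u)) : k = l ∧ t = u := by
  have h₁ := zigzag_lt hs (cyclicSucc_lt hk)
  have h₂ := zigzag_lt hs (cyclicSucc_lt hl)
  have h₃ : zigzag s (cyclicSucc s k) = zigzag s (cyclicSucc s l) → k = l := fun h =>
    cyclicSucc_inj (zigzag_inj hs (cyclicSucc_lt hk) (cyclicSucc_lt hl) h)
  have h3 : ∀ t : Fin 3, t = 0 ∨ t = 1 ∨ t = 2 := by decide
  unfold ladderLabel at h
  rcases h3 t with rfl | rfl | rfl <;> rcases h3 u with rfl | rfl | rfl <;>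
    simp only [Fin.isValue, reduceIte, Fin.reduceEq] at h ⊢ <;> grind

theorem isDegreeMagic_ladder {s : ℕ} (hs : s % 2 = 1) (hs3 : 3 ≤ s) : IsDegreeMagic (ladder s) := by
  let T : Finset (ℕ × Fin 3) := range s ×ˢ univ
  have hT : ∀ q : ℕ × Fin 3, q ∈ T ↔ q.1 < s := by simp [T]
  have hTc : #T = 3 * s := by simp [T, mul_comm]
  have h3 : ∀ t : Fin 3, t = 0 ∨ t = 1 ∨ t = 2 := by decide
  have he : Set.InjOn (ladderEdge s) T := by
    rintro ⟨k, t⟩ hp ⟨l, u⟩ hq h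
    have hp := (hT _).1 hp
    have hq := (hT _).1 hq
    simp only [ladderEdge] at h hp hq
    rcases h3 t with rfl | rfl | rfl <;> rcases h3 u with rfl | rfl | rfl <;>
      simp only [Prod.mk.injEq, and_true, cyclicSucc, Fin.isValue, reduceIte, Fin.reduceEq]
        at h ⊢ <;>
      grind
  have key : ∀ k x l y, ((k, x), (l, y)) ∈ T.image (ladderEdge s) ↔ x = false ∧ y = true ∧
      k < s ∧ l < s ∧ (k = l ∨ l = cyclicSucc s k ∨ k = cyclicSucc s l) := by
    intro k x l y
    simp only [Finset.mem_image]
    constructor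
    · rintro ⟨⟨i, t⟩, hq, h⟩
      have hi := (hT _).1 hq
      have hi' := cyclicSucc_lt hi
      simp only [ladderEdge] at h hi hi'
      rcases h3 t with rfl | rfl | rfl <;>
        simp only [Prod.mk.injEq, Fin.isValue, reduceIte, Fin.reduceEq] at h <;> grind
    · rintro ⟨rfl, rfl, hk, hl, h | h | h⟩
      · exact ⟨(k, 0), (hT _).2 hk, by simp [ladderEdge, h]⟩
      · exact ⟨(k, 1), (hT _).2 hk, by simp [ladderEdge, h]⟩
      · exact ⟨(l, 2), (hT _).2 hl, by simp [ladderEdge, h]⟩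
  refine ⟨T.image (ladderEdge s), _, ⟨?_, ?_⟩, isCentredLabeling_image he
    (l := fun q => 2 * (ladderLabel s q : ℤ) + 1 - (3 * s : ℕ)) ?_ ?_ ?_ ?_⟩
  · rintro ⟨k, x⟩ ⟨l, y⟩
    rw [key, key, ladder_adj]
    cases x <;> cases y <;> simp <;> tauto
  · rintro ⟨k, x⟩ ⟨l, y⟩ h h'
    rw [key] at h h'
    exact absurd (h.1.symm.trans h'.2.1) (by decide)
  · rintro ⟨k, t⟩ hp ⟨l, u⟩ hq h
    have hp := (hT _).1 hp
    have hq := (hT _).1 hq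
    have h' : ladderLabel s (k, t) = ladderLabel s (l, u) := by simpa using h
    obtain ⟨rfl, rfl⟩ := ladderLabel_inj hs hp hq h'
    rfl
  · intro q hq
    have hq := (hT _).1 hq
    have := zigzag_lt hs (cyclicSucc_lt hq)
    have : ladderLabel s q < 3 * s := by
      unfold ladderLabel
      split_ifs <;> lia
    rw [hTc, abs_lt]
    constructor <;> lia
  · intro q hq
    rw [hTc]
    exact ⟨ladderLabel s q, by ring⟩
  · rintro ⟨j, x⟩
    rw [Finset.sum_product]
    by_cases hj : j < s
    · obtain ⟨i, hi, hij⟩ := exists_cyclicSucc_eq hj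
      have hn : ∀ k, cyclicSucc s k = j ↔ k = i := fun k =>
        ⟨fun h => cyclicSucc_inj (h.trans hij.symm), fun h => h ▸ hij⟩
      have hsum := ladder_sum hs hj
      have hjr : j ∈ range s := Finset.mem_range.2 hj
      have hir : i ∈ range s := Finset.mem_range.2 hi
      have hsplit : ∀ F : ℕ → Fin 3 → ℤ, ∑ k ∈ range s, ∑ t : Fin 3, F k t =
          ∑ k ∈ range s, F k 0 + ∑ k ∈ range s, F k 1 + ∑ k ∈ range s, F k 2 := by
        intro F
        simp only [Fin.sum_univ_three, Finset.sum_add_distrib]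
      rw [hsplit]
      cases x
      · have e0 : ∀ k, ((ladderEdge s (k, 0)).1 = (j, false) ∨
            (ladderEdge s (k, 0)).2 = (j, false)) ↔ k = j := by simp [ladderEdge]
        have e1 : ∀ k, ((ladderEdge s (k, 1)).1 = (j, false) ∨
            (ladderEdge s (k, 1)).2 = (j, false)) ↔ k = j := by simp [ladderEdge]
        have e2 : ∀ k, ((ladderEdge s (k, 2)).1 = (j, false) ∨
            (ladderEdge s (k, 2)).2 = (j, false)) ↔ cyclicSucc s k = j := by simp [ladderEdge]
        simp only [e0, e1, e2, hn]
        rw [Finset.sum_ite_eq_of_mem' _ _ _ hjr, Finset.sum_ite_eq_of_mem' _ _ _ hjr,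
          Finset.sum_ite_eq_of_mem' _ _ _ hir]
        simp only [ladderLabel, Fin.isValue, reduceIte, Fin.reduceEq, hij]
        lia
      · have e0 : ∀ k, ((ladderEdge s (k, 0)).1 = (j, true) ∨
            (ladderEdge s (k, 0)).2 = (j, true)) ↔ k = j := by simp [ladderEdge]
        have e1 : ∀ k, ((ladderEdge s (k, 1)).1 = (j, true) ∨
            (ladderEdge s (k, 1)).2 = (j, true)) ↔ cyclicSucc s k = j := by simp [ladderEdge]
        have e2 : ∀ k, ((ladderEdge s (k, 2)).1 = (j, true) ∨
            (ladderEdge s (k, 2)).2 = (j, true)) ↔ k = j := by simp [ladderEdge]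
        simp only [e0, e1, e2, hn]
        rw [Finset.sum_ite_eq_of_mem' _ _ _ hjr, Finset.sum_ite_eq_of_mem' _ _ _ hjr,
          Finset.sum_ite_eq_of_mem' _ _ _ hir]
        simp only [ladderLabel, Fin.isValue, reduceIte, Fin.reduceEq, hij]
        lia
    · refine Finset.sum_eq_zero fun k hk => Finset.sum_eq_zero fun t _ => if_neg ?_
      have hk := Finset.mem_range.1 hk
      have hk' := cyclicSucc_lt hk
      rcases h3 t with rfl | rfl | rfl <;>
        simp only [ladderEdge, Prod.mk.injEq, Fin.isValue, reduceIte, Fin.reduceEq] <;> grind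

/-- Inserting two rungs into the Möbius ladder at its seam enlarges the complement by a fixed graph
on eight vertices and a complete bipartite graph between the four new vertices and the vertices
away from the seam. -/
theorem isBalanced_ladderCompl_sdiff {s : ℕ} (hs : 3 ≤ s) :
    ladderCompl s ≤ ladderCompl (s + 2) ∧
      IsBalanced (ladderCompl (s + 2) \ ladderCompl s) := by
  have hle : ladderCompl s ≤ ladderCompl (s + 2) := by
    rintro ⟨k, x⟩ ⟨l, y⟩
    simp only [ladderCompl_adj, cyclicSucc]
    grind
  refine ⟨hle, ?_⟩
  let N : Finset (ℕ × Bool) := Ico s (s + 2) ×ˢ univ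
  let O : Finset (ℕ × Bool) := Ico 1 (s - 1) ×ˢ univ
  have hN : ∀ p : ℕ × Bool, p ∈ N ↔ s ≤ p.1 ∧ p.1 < s + 2 := by simp [N]
  have hO : ∀ p : ℕ × Bool, p ∈ O ↔ 1 ≤ p.1 ∧ p.1 < s - 1 := by simp [O]
  have hNO : Disjoint N O := Finset.disjoint_left.2 fun p h h' => by
    have := (hN p).1 h
    have := (hO p).1 h'
    lia
  have hb : IsBalanced (bip N O) := by
    have hNc : #N = 4 := by simp [N]
    exact isBalanced_bip hNO (by rw [hNc]; decide) (by simp [O]) (Or.inl (by rw [hNc]))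
  have hble : bip N O ≤ ladderCompl (s + 2) \ ladderCompl s := by
    rintro ⟨k, x⟩ ⟨l, y⟩
    simp only [bip_adj, hN, hO, SimpleGraph.sdiff_adj, ladderCompl_adj, cyclicSucc]
    grind
  refine IsBalanced.of_sdiff hble hb ?_
  let φ : ℕ → ℕ × Bool := fun i =>
    (if i < 2 then s - 1 else if i < 4 then 0 else if i < 6 then s else s + 1, decide (i % 2 = 1))
  refine isMagicList_listLadderStep.isBalanced isBalancedList_listLadderStep (by decide) (φ := φ)
    ?_ ?_ ?_
  · intro i hi j hj h
    rw [Set.mem_Iio] at hi hj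
    simp only [φ, Prod.mk.injEq, decide_eq_decide] at h
    obtain ⟨h₁, h₂⟩ := h
    split_ifs at h₁ <;> lia
  · rintro ⟨k, x⟩ ⟨l, y⟩ h
    have hk : k = s - 1 ∨ k = 0 ∨ k = s ∨ k = s + 1 := by
      simp only [bip_adj, hN, hO, SimpleGraph.sdiff_adj, ladderCompl_adj, cyclicSucc] at h
      grind
    rcases hk with rfl | rfl | rfl | rfl <;> cases x
    · exact ⟨0, by simp [φ]⟩
    · exact ⟨1, by simp [φ]⟩
    · exact ⟨2, by simp [φ]⟩
    · exact ⟨3, by simp [φ]⟩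
    · exact ⟨4, by simp [φ]⟩
    · exact ⟨5, by simp [φ]⟩
    · exact ⟨6, by simp [φ]⟩
    · exact ⟨7, by simp [φ]⟩
  · intro i hi j hj hij
    interval_cases j <;> interval_cases i <;>
      simp [φ, bip_adj, hN, hO, ladderCompl_adj, cyclicSucc] <;> lia

theorem isBalanced_ladderCompl {s : ℕ} (hs : s % 2 = 1) (hs5 : 5 ≤ s) :
    IsBalanced (ladderCompl s) := by
  induction s using Nat.strong_induction_on with
  | _ s ih =>
    rcases hs5.eq_or_lt with rfl | h
    · refine isMagicList_listLadderCompl5.isBalanced isBalancedList_listLadderCompl5 (by decide)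
        (φ := fun i => (i % 5, decide (5 ≤ i))) ?_ ?_ ?_
      · intro i hi j hj h
        rw [Set.mem_Iio] at hi hj
        simp only [Prod.mk.injEq, decide_eq_decide] at h
        lia
      · rintro ⟨k, x⟩ ⟨l, y⟩ h
        have hk := (ladderCompl_adj.1 h).2.1
        simp only at hk
        cases x
        · exact ⟨k, by lia, by simp; lia⟩
        · exact ⟨k + 5, by lia, by simp; lia⟩
      · intro i hi j hj hij
        interval_cases j <;> interval_cases i <;> simp [ladderCompl_adj, cyclicSucc]
    · have h₁ := isBalanced_ladderCompl_sdiff (s := s - 2) (by lia)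
      rw [show s - 2 + 2 = s by lia] at h₁
      exact IsBalanced.of_sdiff h₁.1 (ih _ (by lia) (by lia) (by lia)) h₁.2

theorem isDegreeMagic_completeOn_range {s : ℕ} (hs : s % 2 = 1) (hs5 : 5 ≤ s) :
    IsDegreeMagic (completeOn (range s ×ˢ (univ : Finset Bool))) := by
  refine IsDegreeMagic.of_sdiff ?_ (isDegreeMagic_ladder hs (by lia))
    (isBalanced_ladderCompl hs hs5)
  intro p q h
  rw [ladder_adj] at h
  simp only [completeOn_adj, Finset.mem_product, Finset.mem_range, Finset.mem_univ, and_true]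
  exact ⟨fun hpq => h.1 (congrArg Prod.snd hpq), h.2.1, h.2.2.1⟩

/-! ### Degree-magic regular complete multipartite graphs -/

/-- Degree-magic graphs stay degree-magic under relabeling of the non-isolated vertices. -/
theorem IsDegreeMagic.transfer {V W : Type*} [DecidableEq V] [DecidableEq W] {G : SimpleGraph V}
    {H : SimpleGraph W} (hG : IsDegreeMagic G) {φ : V → W} {X : Set V}
    (hX : ∀ a b, G.Adj a b → a ∈ X) (hφ : Set.InjOn φ X)
    (hadj : ∀ a ∈ X, ∀ b ∈ X, H.Adj (φ a) (φ b) ↔ G.Adj a b)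
    (hH : ∀ x y, H.Adj x y → ∃ a ∈ X, φ a = x) : IsDegreeMagic H := by
  obtain ⟨D, f, hD, hf⟩ := hG
  rcases isEmpty_or_nonempty (V × V) with hV | hV
  · obtain rfl : H = ⊥ := by
      ext x y
      simp only [SimpleGraph.bot_adj, iff_false]
      intro h
      obtain ⟨a, -, -⟩ := hH x y h
      exact hV.elim (a, a)
    exact isBalanced_bot.isDegreeMagic
  have hDX : ∀ p ∈ D, p.1 ∈ X ∧ p.2 ∈ X := fun p hp => by
    have h := (hD.adj_iff p.1 p.2).2 (Or.inl hp)
    exact ⟨hX _ _ h, hX _ _ h.symm⟩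
  have he : Set.InjOn (Prod.map φ φ) D := fun p hp q hq h => by
    have hp := hDX p hp
    have hq := hDX q hq
    exact Prod.ext (hφ hp.1 hq.1 (congrArg Prod.fst h)) (hφ hp.2 hq.2 (congrArg Prod.snd h))
  have hmem : ∀ a ∈ X, ∀ b ∈ X, ((φ a, φ b) ∈ D.image (Prod.map φ φ) ↔ (a, b) ∈ D) := by
    intro a ha b hb
    rw [Finset.mem_image]
    constructor
    · rintro ⟨p, hp, h⟩
      have hp' := hDX p hp
      have h₁ := hφ hp'.1 ha (congrArg Prod.fst h)
      have h₂ := hφ hp'.2 hb (congrArg Prod.snd h)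
      rwa [← h₁, ← h₂]
    · exact fun h => ⟨_, h, rfl⟩
  refine ⟨D.image (Prod.map φ φ), _, ⟨fun x y => ?_, fun x y h h' => ?_⟩,
    isCentredLabeling_image he hf.injOn hf.abs_lt hf.odd fun w => ?_⟩
  · constructor
    · intro h
      obtain ⟨a, ha, rfl⟩ := hH _ _ h
      obtain ⟨b, hb, rfl⟩ := hH _ _ h.symm
      rwa [hmem a ha b hb, hmem b hb a ha, ← hD.adj_iff, ← hadj a ha b hb]
    · rintro (h | h) <;> obtain ⟨p, hp, h⟩ := Finset.mem_image.1 h <;>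
        obtain ⟨rfl, rfl⟩ := Prod.mk.injEq .. ▸ h <;>
        have hG := (hD.adj_iff p.1 p.2).2 (Or.inl hp)
      · exact (hadj _ (hDX p hp).1 _ (hDX p hp).2).2 hG
      · exact ((hadj _ (hDX p hp).1 _ (hDX p hp).2).2 hG).symm
  · obtain ⟨p, hp, h⟩ := Finset.mem_image.1 h
    obtain ⟨rfl, rfl⟩ := Prod.mk.injEq .. ▸ h
    exact hD.asymm _ _ hp ((hmem _ (hDX p hp).2 _ (hDX p hp).1).1 h')
  · by_cases hw : ∃ v ∈ X, φ v = w
    · obtain ⟨v, hv, rfl⟩ := hw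
      rw [← Finset.sum_filter, ← hf.sum_eq v]
      refine Finset.sum_congr (Finset.filter_congr fun p hp => ?_) fun _ _ => rfl
      rw [Prod.map_fst, Prod.map_snd, hφ.eq_iff (hDX p hp).1 hv, hφ.eq_iff (hDX p hp).2 hv]
    · refine Finset.sum_eq_zero fun p hp => if_neg ?_
      rintro (h | h)
      · exact hw ⟨_, (hDX p hp).1, h⟩
      · exact hw ⟨_, (hDX p hp).2, h⟩

/-- The complete multipartite graph on `Fin n` whose parts are the intervals of length `m`. For
`m ∣ n` this is the Turán graph with `n / m` parts. -/
def turan (n m : ℕ) : SimpleGraph (Fin n) where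
  Adj x y := (x : ℕ) / m ≠ (y : ℕ) / m
  symm := ⟨fun _ _ h => h.symm⟩
  loopless := ⟨fun _ h => h rfl⟩

theorem turan_adj {n m : ℕ} {x y : Fin n} : (turan n m).Adj x y ↔ (x : ℕ) / m ≠ (y : ℕ) / m :=
  Iff.rfl

theorem isDegreeMagic_turan_of_multi {r m : ℕ} (hr : 0 < r) (hm : 0 < m)
    (h : IsDegreeMagic (multi (range r) (range m))) : IsDegreeMagic (turan (r * m) m) := by
  have : NeZero (r * m) := ⟨by positivity⟩
  have hval : ∀ i < r, ∀ j < m, i * m + j < r * m := fun i hi j hj =>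
    calc i * m + j < i * m + m := by lia
      _ = (i + 1) * m := by ring
      _ ≤ r * m := Nat.mul_le_mul_right _ hi
  have hφ : ∀ i < r, ∀ j < m, (Fin.ofNat (r * m) (i * m + j) : ℕ) = i * m + j :=
    fun i hi j hj => Nat.mod_eq_of_lt (hval i hi j hj)
  have hdiv : ∀ i j, j < m → (i * m + j) / m = i := fun i j hj => by
    rw [mul_comm, Nat.mul_add_div hm, Nat.div_eq_of_lt hj, add_zero]
  refine h.transfer (φ := fun p => Fin.ofNat (r * m) (p.1 * m + p.2))
    (X := {p | p.1 < r ∧ p.2 < m}) (fun a b hab => ?_) ?_ ?_ ?_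
  · simpa using (multi_adj.1 hab).2.1
  · rintro ⟨i, j⟩ ⟨hi, hj⟩ ⟨i', j'⟩ ⟨hi', hj'⟩ h
    have h := congrArg Fin.val h
    simp only at hi hj hi' hj' h
    rw [hφ i hi j hj, hφ i' hi' j' hj'] at h
    have h₁ : i = i' := by rw [← hdiv i j hj, h, hdiv i' j' hj']
    subst h₁
    simpa using h
  · rintro ⟨i, j⟩ ⟨hi, hj⟩ ⟨i', j'⟩ ⟨hi', hj'⟩
    simp only at hi hj hi' hj'
    simp only [turan_adj, multi_adj, Finset.mem_range, hφ i hi j hj, hφ i' hi' j' hj',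
      hdiv i j hj, hdiv i' j' hj', hi, hj, hi', hj', and_self, and_true]
  · intro x y _
    have hx : (x : ℕ) / m < r := Nat.div_lt_of_lt_mul (x.2.trans_eq (mul_comm r m))
    refine ⟨((x : ℕ) / m, (x : ℕ) % m), ⟨hx, Nat.mod_lt _ hm⟩, Fin.ext ?_⟩
    rw [hφ _ hx _ (Nat.mod_lt _ hm)]
    exact Nat.div_add_mod' _ _

theorem isDegreeMagic_turan_one_of_completeOn {s : ℕ} (hs : 0 < s)
    (h : IsDegreeMagic (completeOn (range s ×ˢ (univ : Finset Bool)))) :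
    IsDegreeMagic (turan (2 * s) 1) := by
  have : NeZero (2 * s) := ⟨by positivity⟩
  have hb : ∀ b : Bool, b.toNat < 2 := by decide
  have htn : ∀ b b' : Bool, b.toNat = b'.toNat → b = b' := by decide
  have hφ : ∀ i < s, ∀ b : Bool, (Fin.ofNat (2 * s) (2 * i + b.toNat) : ℕ) = 2 * i + b.toNat :=
    fun i hi b => Nat.mod_eq_of_lt (by have := hb b; lia)
  have hinj : Set.InjOn (fun p : ℕ × Bool => Fin.ofNat (2 * s) (2 * p.1 + p.2.toNat))
      {p | p.1 < s} := by
    rintro ⟨i, b⟩ hi ⟨i', b'⟩ hi' h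
    have h := congrArg Fin.val h
    simp only [Set.mem_ofPred_eq] at hi hi' h
    rw [hφ i hi, hφ i' hi'] at h
    have := hb b
    have := hb b'
    obtain rfl : i = i' := by lia
    rw [Prod.mk.injEq]
    exact ⟨rfl, htn b b' (by lia)⟩
  refine h.transfer (φ := fun p => Fin.ofNat (2 * s) (2 * p.1 + p.2.toNat))
    (X := {p | p.1 < s}) (fun a b hab => ?_) hinj (fun a ha b hb => ?_) fun x y _ => ?_
  · simpa using (completeOn_adj.1 hab).2.1
  · rw [turan_adj, Nat.div_one, Nat.div_one, ne_eq, Fin.val_inj, hinj.eq_iff ha hb, completeOn_adj]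
    rw [Set.mem_ofPred_eq] at ha hb
    simp [ha, hb]
  · refine ⟨((x : ℕ) / 2, decide ((x : ℕ) % 2 = 1)), Nat.div_lt_of_lt_mul x.2, Fin.ext ?_⟩
    rw [hφ _ (Nat.div_lt_of_lt_mul x.2)]
    rcases Nat.mod_two_eq_zero_or_one x with h | h <;> simp [h] <;> lia

theorem isDegreeMagic_turan_one {n : ℕ} (hn : n = 2 ∨ 6 ≤ n ∧ n % 4 ≠ 0) :
    IsDegreeMagic (turan n 1) := by
  have key : IsDegreeMagic (completeOn (univ : Finset (Fin n))) → IsDegreeMagic (turan n 1) := by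
    intro h
    convert h using 1
    ext x y
    simp [turan_adj, completeOn_adj, Fin.val_inj]
  rcases hn with rfl | ⟨h6, h4⟩
  · exact key (isDegreeMagic_completeOn_of_list (L := [(0, 1)]) (k := 2) (by lia) (by simp)
      (by decide) (by decide))
  by_cases h : n % 2 = 1
  · refine key (isDegreeMagic_completeOn_of_odd ?_ ?_) <;> rw [Finset.card_univ, Fintype.card_fin]
    · exact Nat.odd_iff.2 h
    · lia
  rcases h6.eq_or_lt with rfl | h6
  · exact key (isDegreeMagic_completeOn_of_list (by lia) (by simp) (by decide)
      isMagicList_listComplete6)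
  · obtain ⟨s, rfl⟩ : ∃ s, n = 2 * s := ⟨n / 2, by lia⟩
    exact isDegreeMagic_turan_one_of_completeOn (by lia)
      (isDegreeMagic_completeOn_range (by lia) (by lia))

/-- Existence of degree-magic labelings of the regular complete multipartite graph with `r` parts of
size `m`. -/
theorem isDegreeMagic_turan {r m : ℕ} (hr : 2 ≤ r)
    (h : m = 1 ∧ (r = 2 ∨ 6 ≤ r ∧ r % 4 ≠ 0) ∨ m = 2 ∧ 3 ≤ r ∨
      3 ≤ m ∧ ¬ (r % 4 = 0 ∧ m % 2 = 1)) : IsDegreeMagic (turan (r * m) m) := by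
  rcases h with ⟨rfl, h⟩ | ⟨rfl, h⟩ | ⟨hm, h⟩
  · rw [mul_one]
    exact isDegreeMagic_turan_one h
  · exact isDegreeMagic_turan_of_multi (by lia) (by lia)
      (isBalanced_multi_two (by simpa using h) (by simp)).isDegreeMagic
  · refine isDegreeMagic_turan_of_multi (by lia) (by lia) ?_
    by_cases hm2 : m % 2 = 0
    · exact (isBalanced_multi_of_even (by simpa [Nat.even_iff] using hm2)
        (by rw [Finset.card_range]; lia)).isDegreeMagic
    have hm' : Odd #(range m) := by rw [Finset.card_range, Nat.odd_iff]; lia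
    by_cases hr2 : r % 2 = 1
    · exact isDegreeMagic_multi_of_odd (by simpa [Nat.odd_iff] using hr2) hm' (by simpa using hm)
    · exact isDegreeMagic_multi_of_two_mod_four (by rw [Finset.card_range]; lia) hm'
        (by simpa using hm)

end DegreeMagic

open Finset

/-! ### Optimality of the Turán code -/

section Optimality

variable {n θ α r m : ℕ} {N : Fin n → Finset ℕ}

/-- Every symbol of `U` is stored twice. -/
theorem IsFRCode.sum_card_inter (hN : IsFRCode n θ α 2 N) {U : Finset ℕ} (hU : U ⊆ Icc 1 θ) :
    ∑ x, #(N x ∩ U) = 2 * #U := by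
  have h : ∀ x, #(N x ∩ U) = ∑ s ∈ U, if s ∈ N x then 1 else 0 := fun x => by
    rw [Finset.inter_comm, ← Finset.filter_mem_eq_inter, Finset.card_filter]
  simp only [h]
  rw [Finset.sum_comm, Finset.sum_congr rfl (g := fun _ => 2) fun s hs => ?_, Finset.sum_const,
    smul_eq_mul, mul_comm]
  rw [← Finset.card_filter, hN.card_symbol s (hU hs)]

theorem IsFRCode.biUnion_subset (hN : IsFRCode n θ α 2 N) (I : Finset (Fin n)) :
    I.biUnion N ⊆ Icc 1 θ := Finset.biUnion_subset.2 fun x _ => hN.subset x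

theorem IsFRCode.two_mul_card_biUnion (hN : IsFRCode n θ α 2 N) (I : Finset (Fin n)) :
    2 * #(I.biUnion N) = #I * α + ∑ y ∈ Iᶜ, #(N y ∩ I.biUnion N) := by
  rw [← hN.sum_card_inter (hN.biUnion_subset I), ← Finset.sum_add_sum_compl I,
    Finset.sum_congr rfl (g := fun _ => α) fun x hx => ?_, Finset.sum_const, smul_eq_mul]
  rw [Finset.inter_eq_left.2 (Finset.subset_biUnion_of_mem N hx), hN.card_node]

/-- The largest possible file size for `k ≤ α`: adding a node to `i` nodes that are spread evenly
over the parts of the Turán graph, in a part with the fewest of them, repeats `i - i / r` of the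
symbols. -/
def turanFileSize (r α k : ℕ) : ℤ := ∑ i ∈ range k, ((α : ℤ) - (i - (i / r : ℕ)))

theorem turanFileSize_succ (r α k : ℕ) :
    turanFileSize r α (k + 1) = turanFileSize r α k + (α - (k - (k / r : ℕ))) :=
  Finset.sum_range_succ _ _

theorem two_mul_turanFileSize (r α k : ℕ) : 2 * turanFileSize r α k =
    2 * k * α - k ^ 2 + (2 * (k / r : ℕ) + 1) * k - r * (k / r : ℕ) * ((k / r : ℕ) + 1) := by
  induction k with
  | zero => simp [turanFileSize]
  | succ k ih =>
    rw [turanFileSize_succ, mul_add, ih]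
    by_cases h : r ∣ k + 1
    · have h₁ : (k + 1) / r = k / r + 1 := by rw [Nat.succ_div, if_pos h]
      have h₂ : ((k + 1 : ℕ) : ℤ) = r * (k / r + 1 : ℕ) := by
        rw [← h₁]; exact_mod_cast (Nat.mul_div_cancel' h).symm
      rw [h₁]
      push_cast at h₂ ⊢
      linear_combination (-2) * h₂
    · rw [Nat.succ_div, if_neg h, add_zero]
      push_cast
      ring

/-- Greedy choice: the next node is taken to share the most symbols with the present ones. -/
theorem IsFRCode.exists_card_biUnion_le (hN : IsFRCode n θ α 2 N) (hr : 2 ≤ r) (hn : n = r * m)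
    (hα : α = (r - 1) * m) {k : ℕ} (hk : k ≤ α) :
    ∃ I : Finset (Fin n), #I = k ∧ (#(I.biUnion N) : ℤ) ≤ turanFileSize r α k := by
  have hm : 0 < m := by
    have := hN.n_pos
    rw [hn] at this
    exact Nat.pos_of_mul_pos_left this
  have hnα : n = α + m := by
    obtain ⟨r, rfl⟩ : ∃ r', r = r' + 1 := ⟨r - 1, by lia⟩
    rw [hn, hα, Nat.add_sub_cancel]
    ring
  induction k with
  | zero => exact ⟨∅, rfl, by simp [turanFileSize]⟩
  | succ k ih =>
    obtain ⟨I, hI, hle⟩ := ih (by lia)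
    set U := I.biUnion N with hU
    have hdc := hN.two_mul_card_biUnion I
    rw [← hU, hI] at hdc
    have hIc : #Iᶜ = n - k := by rw [Finset.card_compl, Fintype.card_fin, hI]
    -- Some node outside `I` shares at least the average number of symbols with `U`.
    obtain ⟨j, hj, hd⟩ : ∃ j ∈ Iᶜ, ∑ y ∈ Iᶜ, #(N y ∩ U) ≤ #Iᶜ * #(N j ∩ U) := by
      obtain ⟨j, hj, hmax⟩ := Finset.exists_max_image Iᶜ (fun y => #(N y ∩ U))
        (Finset.card_pos.1 (by lia))
      exact ⟨j, hj, by simpa using Finset.sum_le_card_nsmul _ _ _ hmax⟩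
    rw [Finset.mem_compl] at hj
    refine ⟨insert j I, by rw [Finset.card_insert_of_notMem hj, hI], ?_⟩
    rw [Finset.biUnion_insert, ← hU, turanFileSize_succ]
    have hcard := Finset.card_union_add_card_inter (N j) U
    rw [hN.card_node] at hcard
    have hF := two_mul_turanFileSize r α k
    obtain ⟨x, hx⟩ : ∃ x : ℤ, x = turanFileSize r α k - #U := ⟨_, rfl⟩
    obtain ⟨q, hq⟩ : ∃ q, k / r = q := ⟨_, rfl⟩
    obtain ⟨s, hs⟩ : ∃ s, k % r = s := ⟨_, rfl⟩
    have hsr : s < r := hs ▸ Nat.mod_lt _ (by lia)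
    have hkq : k = r * q + s := by rw [← hq, ← hs, Nat.div_add_mod]
    have hqm : q < m := by
      rw [← hq]
      exact Nat.div_lt_of_lt_mul (by lia)
    rw [hq] at hF ⊢
    rw [hIc] at hd
    generalize #(N j ∩ U) = d at *
    generalize #(N j ∪ U) = u' at *
    generalize #U = u at *
    generalize turanFileSize r α k = F at *
    have hx0 : 0 ≤ x := by lia
    suffices h : (k : ℤ) - q - x ≤ d by lia
    by_contra! hlt
    -- The average exceeds `k - q - x - 1`, because `n - k = r (m - q) - s` and `n - k ≥ 2`.
    have h₁ : 2 * (u : ℤ) - k * α ≤ (n - k) * d := by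
      zify [show k ≤ n by lia] at hd hdc
      lia
    have h₂ : ((n : ℤ) - k) * d ≤ (n - k) * (k - q - x - 1) :=
      mul_le_mul_of_nonneg_left (by lia) (by lia)
    have hnk : (2 : ℤ) ≤ n - k := by lia
    have hnZ : (n : ℤ) = r * m := by exact_mod_cast hn
    have hαZ : (α : ℤ) = r * m - m := by lia
    have hkZ : (k : ℤ) = r * q + s := by exact_mod_cast hkq
    have h₃ : (0 : ℤ) < (r - s) * (m - q) := mul_pos (by lia) (by lia)
    have h₄ : 0 ≤ x * (n - k - 2) := mul_nonneg hx0 (by lia)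
    have h₅ : 2 * (u : ℤ) = 2 * F - 2 * x := by lia
    have h₆ : (0 : ℤ) ≤ -(2 * F - 2 * x - k * α) + (n - k) * (k - q - x - 1) := by lia
    rw [hF] at h₆
    rw [hαZ, hkZ] at h₆
    rw [hnZ] at h₆ h₄
    rw [hkZ] at h₄
    nlinarith

theorem card_filter_div_eq (hn : n = r * m) (hm : 0 < m) {i : ℕ} (hi : i < r) :
    #{y : Fin n | (y : ℕ) / m = i} = m := by
  have himg : (univ.filter fun y : Fin n => (y : ℕ) / m = i).map Fin.valEmbedding =
      Ico (i * m) (i * m + m) := by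
    have hle : (i + 1) * m ≤ r * m := Nat.mul_le_mul_right _ hi
    ext a
    simp only [Finset.mem_map, Finset.mem_filter, Finset.mem_univ, true_and, Fin.valEmbedding_apply,
      Finset.mem_Ico]
    constructor
    · rintro ⟨y, rfl, rfl⟩
      exact ⟨Nat.div_mul_le_self _ _, Nat.lt_div_mul_add hm⟩
    · rintro ⟨h₁, h₂⟩
      refine ⟨⟨a, by lia⟩, Nat.div_eq_of_lt_le h₁ (by lia), rfl⟩
  rw [← Finset.card_map, himg, Nat.card_Ico]
  lia

/-- A set of `k` vertices of the Turán graph splits into parts of sizes `kᵢ`, and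
`∑ kᵢ ^ 2` is smallest when the `kᵢ` take only the values `k / r` and `k / r + 1`. -/
theorem IsFRCode.turanFileSize_le (hN : IsFRCode n θ α 2 N) (hr : 2 ≤ r) (hn : n = r * m)
    (hα : α = (r - 1) * m)
    (hadj : ∀ x y : Fin n, (x : ℕ) / m ≠ (y : ℕ) / m →
      ∃ s, s ∈ N x ∧ s ∈ N y ∧ ∀ z, s ∈ N z → z = x ∨ z = y) (I : Finset (Fin n)) :
    turanFileSize r α #I ≤ #(I.biUnion N) := by
  have hm : 0 < m := by
    have := hN.n_pos
    rw [hn] at this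
    exact Nat.pos_of_mul_pos_left this
  have hcr : ∀ x : Fin n, (x : ℕ) / m ∈ range r := fun x => by
    rw [Finset.mem_range]
    exact Nat.div_lt_of_lt_mul (x.2.trans_eq (hn.trans (mul_comm _ _)))
  let c : Fin n → ℕ := fun x => (x : ℕ) / m
  let κ : ℕ → ℕ := fun i => #{x ∈ I | c x = i}
  have hκ : ∑ i ∈ range r, κ i = #I := (Finset.card_eq_sum_card_fiberwise fun x _ => hcr x).symm
  -- A node outside `I` shares one symbol with each node of `I` in a different part.
  have hshare : ∀ y ∈ Iᶜ, (#I : ℤ) - κ (c y) ≤ #(N y ∩ I.biUnion N) := by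
    intro y hy
    rw [Finset.mem_compl] at hy
    have hsplit := Finset.card_filter_add_card_filter_not (s := I) (fun x => c x = c y)
    have hinj : #{x ∈ I | ¬ c x = c y} ≤ #(N y ∩ I.biUnion N) := by
      choose! f hf using fun x (hx : c x ≠ c y) => hadj x y hx
      refine Finset.card_le_card_of_injOn f (fun x hx => ?_) fun x hx x' hx' h => ?_
      · obtain ⟨hxI, hxc⟩ := Finset.mem_filter.1 hx
        exact Finset.mem_inter.2 ⟨(hf x hxc).2.1, Finset.mem_biUnion.2 ⟨x, hxI, (hf x hxc).1⟩⟩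
      · obtain ⟨hxI, hxc⟩ := Finset.mem_filter.1 hx
        obtain ⟨-, hxc'⟩ := Finset.mem_filter.1 hx'
        refine ((hf x' hxc').2.2 x (h ▸ (hf x hxc).1)).resolve_right ?_
        rintro rfl
        exact hy hxI
    change _ - ((#{x ∈ I | c x = c y} : ℕ) : ℤ) ≤ _
    lia
  have hdc := hN.two_mul_card_biUnion I
  have hsum := Finset.sum_le_sum hshare
  have hIn : #I ≤ n := by simpa using Finset.card_le_univ I
  have hIc : #Iᶜ = n - #I := by rw [Finset.card_compl, Fintype.card_fin]
  rw [Finset.sum_sub_distrib, Finset.sum_const, hIc, nsmul_eq_mul, Nat.cast_sub hIn] at hsum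
  have hall : ∑ y, (κ (c y) : ℤ) = m * #I := by
    have hfib : ∀ i ∈ range r, #{y : Fin n | c y = i} = m := fun i hi =>
      card_filter_div_eq hn hm (Finset.mem_range.1 hi)
    rw [← Finset.sum_fiberwise_of_maps_to (t := range r) (g := c) fun y _ => hcr y, ← hκ]
    push_cast
    rw [Finset.mul_sum]
    refine Finset.sum_congr rfl fun i hi => ?_
    rw [Finset.sum_congr rfl (g := fun _ => (κ i : ℤ)) fun y hy => by
      rw [(Finset.mem_filter.1 hy).2], Finset.sum_const, hfib i hi, nsmul_eq_mul]
  have hsq : ∑ y ∈ I, (κ (c y) : ℤ) = ∑ i ∈ range r, (κ i : ℤ) ^ 2 := by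
    rw [← Finset.sum_fiberwise_of_maps_to (t := range r) (g := c) fun y _ => hcr y]
    refine Finset.sum_congr rfl fun i _ => ?_
    rw [Finset.sum_congr rfl (g := fun _ => (κ i : ℤ)) fun y hy => by
      rw [(Finset.mem_filter.1 hy).2], Finset.sum_const, nsmul_eq_mul, sq]
  have hcompl := Finset.sum_add_sum_compl I fun y => (κ (c y) : ℤ)
  rw [hall, hsq] at hcompl
  obtain ⟨q, hq⟩ : ∃ q, #I / r = q := ⟨_, rfl⟩
  -- `(k - q) (k - q - 1)` is nonnegative for every integer `k`.
  have hconv : (2 * q + 1) * (#I : ℤ) - r * q * (q + 1) ≤ ∑ i ∈ range r, (κ i : ℤ) ^ 2 := by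
    have h : ∀ i ∈ range r, (2 * q + 1) * (κ i : ℤ) - q * (q + 1) ≤ (κ i : ℤ) ^ 2 := by
      intro i _
      rcases le_or_gt (κ i : ℤ) q with h | h
      · nlinarith
      · nlinarith [mul_nonneg (show (0 : ℤ) ≤ κ i - q by lia) (show (0 : ℤ) ≤ κ i - q - 1 by lia)]
    have := Finset.sum_le_sum h
    rw [Finset.sum_sub_distrib, ← Finset.mul_sum, Finset.sum_const, Finset.card_range,
      nsmul_eq_mul] at this
    rw [← hκ]
    push_cast
    lia
  have hF := two_mul_turanFileSize r α #I
  rw [hq] at hF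
  zify at hdc
  have hnα : (n : ℤ) = α + m := by
    obtain ⟨r, rfl⟩ : ∃ r', r = r' + 1 := ⟨r - 1, by lia⟩
    rw [hn, hα, Nat.add_sub_cancel]
    push_cast
    ring
  rw [hnα] at hsum
  nlinarith

theorem isOptimalFRCode_of_turan (hN : IsFRCode n θ α 2 N) (hr : 2 ≤ r) (hn : n = r * m)
    (hα : α = (r - 1) * m)
    (hadj : ∀ x y : Fin n, (x : ℕ) / m ≠ (y : ℕ) / m →
      ∃ s, s ∈ N x ∧ s ∈ N y ∧ ∀ z, s ∈ N z → z = x ∨ z = y) : IsOptimalFRCode n θ α 2 N := by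
  refine ⟨hN, fun k hk => ⟨⟨θ, N, hN, rfl⟩, ?_⟩⟩
  rintro M ⟨θ', N', hN', rfl⟩
  obtain ⟨I', hI', hle⟩ := hN'.exists_card_biUnion_le hr hn hα hk
  obtain ⟨I₀, hI₀, -⟩ := hN.exists_card_biUnion_le hr hn hα hk
  obtain ⟨I, hI, hmin⟩ := Nat.sInf_mem (s := {a : ℕ | ∃ I : Finset (Fin n), #I = k ∧
    #(I.biUnion N) = a}) ⟨_, I₀, hI₀, rfl⟩
  have h₁ : fileSize N' k ≤ #(I'.biUnion N') := Nat.sInf_le ⟨I', hI', rfl⟩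
  have h₂ := hN.turanFileSize_le hr hn hα hadj I
  have h₃ : fileSize N k = #(I.biUnion N) := hmin.symm
  rw [hI] at h₂
  lia

end Optimality

/-! ### From degree-magic graphs to labeled set systems -/

namespace DegreeMagic

/-- A degree-magic labeling of `G`, read as a labeling of the set system of edges of `G`. -/
theorem IsDegreeMagic.exists_labeling {V : Type*} [Fintype V] [DecidableEq V] {G : SimpleGraph V}
    (hG : IsDegreeMagic G) : ∃ (S : SetSystem V) (σ : S.Labeling),
      (∀ B, B ∈ S.blocks ↔ ∃ a b, G.Adj a b ∧ B = {a, b}) ∧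
      ∀ x, 2 * ∑ e : S.blocks, (if x ∈ e.1 then ((σ e : ℕ) : ℤ) else 0) =
        #{e ∈ S.blocks | x ∈ e} * (S.size + 1) := by
  obtain ⟨D, f, hD, hf⟩ := hG
  let blk : V × V → Finset V := fun p => {p.1, p.2}
  have hpair : ∀ a b c d : V, ({a, b} : Finset V) = {c, d} → a = c ∧ b = d ∨ a = d ∧ b = c := by
    intro a b c d h
    rw [← Finset.coe_inj] at h
    push_cast at h
    exact Set.pair_eq_pair_iff.1 h
  have hblk : Set.InjOn blk D := by
    rintro ⟨a, b⟩ hp ⟨c, d⟩ hq h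
    rcases hpair _ _ _ _ h with ⟨h₁, h₂⟩ | ⟨h₁, h₂⟩
    · exact Prod.ext h₁ h₂
    · simp only at h₁ h₂
      subst h₁ h₂
      exact absurd hq (hD.asymm _ _ hp)
  let S : SetSystem V := ⟨D.image blk⟩
  have hsize : S.size = #D := Finset.card_image_of_injOn hblk
  have hex : ∀ e : S.blocks, ∃ p ∈ D, blk p = e := fun e => Finset.mem_image.1 e.2
  choose P hPD hP using hex
  have hPinj : Function.Injective P := fun e e' h => Subtype.ext (by rw [← hP, ← hP, h])
  have hval : ∀ e, ∃ l : ℕ, 2 * (l : ℤ) = f (P e) + #D + 1 ∧ l ∈ Icc 1 S.size := by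
    intro e
    obtain ⟨z, hz⟩ := hf.odd _ (hPD e)
    have := abs_lt.1 (hf.abs_lt _ (hPD e))
    refine ⟨(z + 1).toNat, by lia, Finset.mem_Icc.2 ?_⟩
    rw [hsize]
    lia
  choose l hl hlI using hval
  let g : S.blocks → Icc 1 S.size := fun e => ⟨l e, hlI e⟩
  have hg : Function.Bijective g := by
    refine (Fintype.bijective_iff_injective_and_card g).2 ⟨fun e e' h => ?_, ?_⟩
    · have h : l e = l e' := congrArg Subtype.val h
      refine hPinj (hf.injOn (hPD e) (hPD e') ?_)
      have h₁ := hl e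
      have h₂ := hl e'
      rw [h] at h₁
      lia
    · rw [Fintype.card_coe, Fintype.card_coe, Nat.card_Icc]
      rfl
  refine ⟨S, Equiv.ofBijective g hg, fun B => ?_, fun x => ?_⟩
  · simp only [S, Finset.mem_image, hD.adj_iff]
    constructor
    · rintro ⟨p, hp, rfl⟩
      exact ⟨p.1, p.2, Or.inl hp, rfl⟩
    · rintro ⟨a, b, h | h, rfl⟩
      · exact ⟨_, h, rfl⟩
      · exact ⟨_, h, Finset.pair_comm _ _⟩
  · have hsum : ∑ e : S.blocks, (if x ∈ e.1 then f (P e) else 0) = 0 := by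
      refine Eq.trans ?_ (hf.sum_eq x)
      rw [Finset.sum_filter]
      refine Finset.sum_bij (fun e _ => P e) (fun e _ => hPD e) (fun e _ e' _ h => hPinj h)
        (fun p hp => ⟨⟨blk p, Finset.mem_image_of_mem _ hp⟩, Finset.mem_univ _,
          hblk (hPD _) hp (hP _)⟩) fun e _ => ?_
      have : x ∈ e.1 ↔ (P e).1 = x ∨ (P e).2 = x := by
        rw [← hP e]
        simp only [blk, Finset.mem_insert, Finset.mem_singleton, eq_comm]
      exact if_congr this rfl rfl
    have hcount : ∑ e : S.blocks, (if x ∈ e.1 then (1 : ℤ) else 0) = #{e ∈ S.blocks | x ∈ e} := by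
      rw [Finset.sum_coe_sort S.blocks fun e => if x ∈ e then (1 : ℤ) else 0, Finset.sum_boole]
    rw [← hcount, Finset.mul_sum, Finset.sum_mul]
    have : ∑ e : S.blocks, (if x ∈ e.1 then (1 : ℤ) else 0) * ((S.size : ℤ) + 1) =
        ∑ e : S.blocks, ((if x ∈ e.1 then (1 : ℤ) else 0) * ((S.size : ℤ) + 1) +
          if x ∈ e.1 then f (P e) else 0) := by
      rw [Finset.sum_add_distrib, hsum, add_zero]
    rw [this]
    refine Finset.sum_congr rfl fun e _ => ?_
    have := hl e
    have hge : (Equiv.ofBijective g hg e : ℕ) = l e := rfl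
    rw [hge]
    have hsize' : (S.size : ℤ) = #D := by rw [hsize]
    split_ifs <;> lia

end DegreeMagic

namespace SetSystem

variable {V : Type*} [Fintype V] [DecidableEq V] {S : SetSystem V}

theorem accessVar_eq_zero {α : ℕ} {σ : S.Labeling} (hreg : S.IsRegular α)
    (h : ∀ x, 2 * ∑ e : S.blocks, (if x ∈ e.1 then ((σ e : ℕ) : ℤ) else 0) =
      #{e ∈ S.blocks | x ∈ e} * (S.size + 1)) : S.accessVar α σ = 0 := by
  refine Finset.sum_eq_zero fun x _ => ?_
  have hx := h x
  rw [hreg x] at hx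
  have hp : S.popularity σ x = ∑ e : S.blocks, (if x ∈ e.1 then ((σ e : ℕ) : ℝ) else 0) := by
    simp only [popularity, Matrix.mulVec, dotProduct, incidence, ite_mul, one_mul, zero_mul]
  have hx' : 2 * S.popularity σ x = α * (S.size + 1) := by
    rw [hp]
    exact_mod_cast hx
  rw [sq_eq_zero_iff]
  linarith

theorem minVar_eq_zero {α : ℕ} {σ : S.Labeling} (h : S.accessVar α σ = 0) : S.minVar α = 0 := by
  have hnn : ∀ τ : S.Labeling, 0 ≤ S.accessVar α τ := fun τ =>
    Finset.sum_nonneg fun x _ => sq_nonneg _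
  have : Nonempty S.Labeling := ⟨σ⟩
  refine le_antisymm ?_ (le_ciInf hnn)
  rw [← h]
  exact ciInf_le ⟨0, by rintro _ ⟨τ, rfl⟩; exact hnn τ⟩ σ

omit [Fintype V] in
theorem mem_frCode {σ : S.Labeling} {x : V} {s : ℕ} :
    s ∈ S.frCode σ x ↔ ∃ e : S.blocks, x ∈ e.1 ∧ (σ e : ℕ) = s := by
  simp [frCode]

omit [Fintype V] in
theorem coe_mem_frCode {σ : S.Labeling} {x : V} {e : S.blocks} :
    (σ e : ℕ) ∈ S.frCode σ x ↔ x ∈ e.1 := by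
  rw [mem_frCode]
  constructor
  · rintro ⟨e', hx, h⟩
    rwa [σ.injective (Subtype.ext h)] at hx
  · exact fun h => ⟨e, h, rfl⟩

theorem isFRCode_frCode {n α : ℕ} {S : SetSystem (Fin n)} (σ : S.Labeling) (hn : 0 < n)
    (hα : 0 < α) (hunif : S.IsUniform 2) (hreg : S.IsRegular α) :
    IsFRCode n S.size α 2 (S.frCode σ) := by
  have hnode : ∀ x, #(S.frCode σ x) = α := by
    intro x
    rw [frCode, Finset.card_image_of_injective _ fun e e' h => σ.injective (Subtype.ext h),
      ← hreg x, Finset.card_filter, Finset.card_filter,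
      Finset.sum_coe_sort S.blocks fun e => if x ∈ e then 1 else 0]
  have hsub : ∀ x, S.frCode σ x ⊆ Icc 1 S.size := by
    intro x s hs
    obtain ⟨e, -, rfl⟩ := mem_frCode.1 hs
    exact (σ e).2
  have hsymb : ∀ s ∈ Icc 1 S.size, #{x | s ∈ S.frCode σ x} = 2 := by
    intro s hs
    obtain ⟨e, he⟩ := σ.surjective ⟨s, hs⟩
    have he : (σ e : ℕ) = s := congrArg Subtype.val he
    rw [← hunif e.1 e.2, ← he]
    simp only [coe_mem_frCode]
    rw [Finset.filter_univ_mem]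
  have hmul : n * α = S.size * 2 := by
    have h₁ : ∑ x : Fin n, #(S.frCode σ x) = n * α := by simp [hnode]
    have h₂ : ∀ x, #(S.frCode σ x) = ∑ s ∈ Icc 1 S.size, if s ∈ S.frCode σ x then 1 else 0 :=
      fun x => by
        rw [← Finset.card_filter, Finset.filter_mem_eq_inter, Finset.inter_eq_right.2 (hsub x)]
    rw [← h₁, Finset.sum_congr rfl fun x _ => h₂ x, Finset.sum_comm,
      Finset.sum_congr rfl (g := fun _ => 2) fun s hs => by rw [← Finset.card_filter, hsymb s hs]]
    simp
  refine ⟨hn, ?_, hα, two_pos, hmul, hsub, hnode, hsymb⟩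
  have := Nat.mul_pos hn hα
  lia

end SetSystem

theorem corollary3p5 (n r α : ℕ) (hr : 2 ≤ r) (hrn : r ∣ n) (hα : α = (r - 1) * (n / r))
    (h : (n = r ∧ (n = 2 ∨ (6 ≤ n ∧ ¬ n ≡ 0 [MOD 4]))) ∨
      (n = 2 * r ∧ 6 ≤ n) ∨
      (3 * r ≤ n ∧ ¬ (r ≡ 0 [MOD 4] ∧ Odd (n / r)))) :
    ∃ (S : SetSystem (Fin n)) (σ : S.Labeling),
      IsMinVarFRCode n α 2 S σ ∧
      IsOptimalFRCode n S.size α 2 (S.frCode σ) ∧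
      S.accessVar α σ = 0 := by
  obtain ⟨m, hnm⟩ := hrn
  have hr0 : 0 < r := by lia
  have hdiv : n / r = m := by rw [hnm, Nat.mul_div_cancel_left _ hr0]
  rw [hdiv] at hα h
  have hcase : m = 1 ∧ (r = 2 ∨ 6 ≤ r ∧ r % 4 ≠ 0) ∨ m = 2 ∧ 3 ≤ r ∨
      3 ≤ m ∧ ¬ (r % 4 = 0 ∧ m % 2 = 1) := by
    rcases h with ⟨h₁, h₂⟩ | ⟨h₁, h₂⟩ | ⟨h₁, h₂⟩
    · have : m = 1 := by
        rw [hnm] at h₁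
        exact Nat.eq_of_mul_eq_mul_left hr0 (h₁.trans (mul_one r).symm)
      rw [h₁] at h₂
      exact Or.inl ⟨this, h₂⟩
    · have : m = 2 := by
        rw [hnm, mul_comm] at h₁
        exact Nat.eq_of_mul_eq_mul_right hr0 h₁
      exact Or.inr (Or.inl ⟨this, by lia⟩)
    · have : 3 ≤ m := by
        rw [hnm, mul_comm] at h₁
        exact Nat.le_of_mul_le_mul_left h₁ hr0
      rw [Nat.odd_iff] at h₂
      exact Or.inr (Or.inr ⟨this, h₂⟩)
  have hm : 0 < m := by lia
  have hmagic : DegreeMagic.IsDegreeMagic (DegreeMagic.turan n m) := by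
    rw [hnm]
    exact DegreeMagic.isDegreeMagic_turan hr hcase
  obtain ⟨S, σ, hblk, hsum⟩ := hmagic.exists_labeling
  have hunif : S.IsUniform 2 := by
    intro e he
    obtain ⟨a, b, hab, rfl⟩ := (hblk e).1 he
    exact Finset.card_pair hab.ne
  have hreg : S.IsRegular α := by
    intro x
    have himg : (S.blocks.filter fun e => x ∈ e) =
        (univ.filter fun y : Fin n => ¬ (y : ℕ) / m = (x : ℕ) / m).image fun y => {x, y} := by
      ext e
      simp only [Finset.mem_filter, hblk, Finset.mem_image, Finset.mem_univ, true_and]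
      constructor
      · rintro ⟨⟨a, b, hab, rfl⟩, hx⟩
        rw [DegreeMagic.turan_adj] at hab
        rw [Finset.mem_insert, Finset.mem_singleton] at hx
        rcases hx with rfl | rfl
        · exact ⟨b, Ne.symm hab, rfl⟩
        · exact ⟨a, hab, Finset.pair_comm _ _⟩
      · rintro ⟨y, hy, rfl⟩
        exact ⟨⟨x, y, Ne.symm hy, rfl⟩, Finset.mem_insert_self _ _⟩
    rw [himg, Finset.card_image_of_injOn]
    · have h₁ := card_filter_div_eq hnm hm
        (Nat.div_lt_of_lt_mul (x.2.trans_eq (hnm.trans (mul_comm _ _))))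
      have h₂ := Finset.card_filter_add_card_filter_not (s := univ)
        (fun y : Fin n => (y : ℕ) / m = (x : ℕ) / m)
      rw [h₁, Finset.card_univ, Fintype.card_fin] at h₂
      have h₃ : n = α + m := by
        obtain ⟨r, rfl⟩ : ∃ r', r = r' + 1 := ⟨r - 1, by lia⟩
        rw [hnm, hα, Nat.add_sub_cancel]
        ring
      lia
    · intro y hy z hz hyz
      have hz' : z ∈ ({x, y} : Finset (Fin n)) := by
        rw [show ({x, y} : Finset (Fin n)) = {x, z} from hyz]
        simp
      rw [Finset.mem_insert, Finset.mem_singleton] at hz'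
      rcases hz' with rfl | rfl
      · exact absurd rfl (Finset.mem_filter.1 hz).2
      · rfl
  have hvar := SetSystem.accessVar_eq_zero hreg hsum
  have hcode := SetSystem.isFRCode_frCode σ (by rw [hnm]; positivity)
    (by rw [hα]; exact Nat.mul_pos (by lia) hm) hunif hreg
  refine ⟨S, σ, ⟨hunif, hreg, by rw [hvar, SetSystem.minVar_eq_zero hvar]⟩,
    isOptimalFRCode_of_turan hcode hr hnm hα fun x y hxy => ?_, hvar⟩
  have hmem : ({x, y} : Finset (Fin n)) ∈ S.blocks := (hblk _).2 ⟨x, y, hxy, rfl⟩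
  refine ⟨σ ⟨_, hmem⟩, ?_, ?_, fun z hz => ?_⟩
  · simp [SetSystem.coe_mem_frCode]
  · simp [SetSystem.coe_mem_frCode]
  · simpa [SetSystem.coe_mem_frCode] using hz
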